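/- For a finite group $G$ and $x\colon G\to\mathbb{C}$ let $P_x=[x(hg^{-1})]_{h,g\in G}$ be the matrix of the convolution operator $v\mapsto x*v$ on $\mathbb{C}^G$, and let $\widetilde\mu_G$ be the image of the Plancherel measure $\mu_G(\Lambda)=(\dim\Lambda)^2/|G|$ on the set $\widehat G$ of equivalence classes of irreducible unitary representations under $\Lambda\mapsto\dim\Lambda$, viewed as a probability measure on the one-point compactification $\{1,2,\dots\}\cup\{\infty\}$. A $C^*$-probability space is a unital $C^*$-algebra $\mathcal A$ with a linear functional $\varphi$ such that $\varphi(\mathbf 1)=1$, $\varphi(a^*)=\overline{\varphi(a)}$ and $\varphi(aa^*)\ge 0$. Unital subalgebras $(\mathcal A_i)$ are free if $\varphi(a_1\cdots a_n)=0$ whenever $n\ge1$, $a_k\in\mathcal A_{i_k}$, $\varphi(a_k)=0$ for all $k$, and $i_k\ne i_{k+1}$ for $k<n$; subsets are free if the unital subalgebras that they generate are free. A self-adjoint $a\in\mathcal A$ is semicircular if $\varphi(a^{2k+1})=0$ and $\varphi(a^{2k})=\frac1{k+1}\binom{2k}{k}$ for all $k\ge0$, and $c\in\mathcal A$ is circular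 if $c=(a+\sqrt{-1}\,b)/\sqrt2$ with $a,b$ free semicircular elements. Theorem. Let $G_N$ be a sequence of finite groups with $|G_N|\to\infty$ such that $\widetilde\mu_{G_N}$ converges weakly to the Dirac mass at $\infty$. Let $\xi$ be a complex random variable with finite moments of all orders and $\mathbb{E}\xi=\mathbb{E}\xi^2=0$, $\mathbb{E}|\xi|^2=1$. For each $N$ let $X^{N,1}=(X^{N,1}_g)_{g\in G_N},\dots,X^{N,m}=(X^{N,m}_g)_{g\in G_N}$ be independent families of independent copies of $\xi$. Then the family of random matrices $$\big(|G_N|^{-1/2}P_{X^{N,1}},\,|G_N|^{-1/2}P_{X^{N,1}}^*,\dots,|G_N|^{-1/2}P_{X^{N,m}},\,|G_N|^{-1/2}P_{X^{N,m}}^*\big)$$ converges in moments, with respect to $\frac1{|G_N|}\mathbb{E}\operatorname{tr}$, to $(c_1,c_1^*,\dots,c_m,c_m^*)$, where $c_1,\dots,c_m$ are circular elements of a $C^*$-probability space $(\mathcal A,\varphi)$ such that $\{c_1,c_1^*\},\dots,\{c_m,c_m^*\}$ are free. That is, such $c_1,\dots,c_m$ exist, and for any such family and every noncommutative polynomial $Q$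 in $2m$ variables, the random variable $\operatorname{tr}Q(|G_N|^{-1/2}P_{X^{N,1}},\dots,|G_N|^{-1/2}P_{X^{N,m}}^*)$ is integrable for every $N$ and $$\lim_{N\to\infty}\frac1{|G_N|}\,\mathbb{E}\operatorname{tr}Q\big(|G_N|^{-1/2}P_{X^{N,1}},|G_N|^{-1/2}P_{X^{N,1}}^*,\dots,|G_N|^{-1/2}P_{X^{N,m}},|G_N|^{-1/2}P_{X^{N,m}}^*\big)=\varphi\big(Q(c_1,c_1^*,\dots,c_m,c_m^*)\big).$$ -/

import Mathlib

open MeasureTheory ProbabilityTheory Filter Topology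

noncomputable section

section Plancherel

/-- The representation of `G` on `ℂⁿ` given by a homomorphism into the group of unitary
`n × n` matrices. -/
def unitaryRep {G : Type*} [Group G] {n : ℕ+} (ρ : G →* Matrix.unitaryGroup (Fin n) ℂ) :
    Representation ℂ G (Fin n → ℂ) :=
  (Matrix.toLinAlgEquiv' : Matrix (Fin n) (Fin n) ℂ ≃ₐ[ℂ] _).toMulEquiv.toMonoidHom.comp
    ((Matrix.unitaryGroup (Fin n) ℂ).subtype.comp ρ)

/-- Irreducible unitary matrix representations of `G` of dimension `n`. -/
def IrrUnitaryRep (G : Type*) [Group G] (n : ℕ+) : Type _ :=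
  {ρ : G →* Matrix.unitaryGroup (Fin n) ℂ // (unitaryRep ρ).IsIrreducible}

/-- Equivalence (isomorphism) of representations. -/
instance irrUnitaryRepSetoid (G : Type*) [Group G] (n : ℕ+) : Setoid (IrrUnitaryRep G n) where
  r ρ σ := Nonempty ((unitaryRep ρ.1).Equiv (unitaryRep σ.1))
  iseqv :=
    ⟨fun _ => ⟨Representation.Equiv.refl _⟩, fun ⟨e⟩ => ⟨e.symm⟩, fun ⟨e⟩ ⟨f⟩ => ⟨e.trans f⟩⟩

/-- The dual `Ĝ`: the set of equivalence classes of irreducible unitary representations. -/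
def UnitaryDual (G : Type*) [Group G] : Type _ :=
  Σ n : ℕ+, Quotient (irrUnitaryRepSetoid G n)

/-- The dimension of (a class of) an irreducible representation. -/
def UnitaryDual.dim {G : Type*} [Group G] (Λ : UnitaryDual G) : ℕ+ := Λ.1

instance (G : Type*) [Group G] : MeasurableSpace (UnitaryDual G) := ⊤

/-- The Plancherel measure on `Ĝ`: the class `Λ` has mass `(dim Λ)² / |G|`. -/
def plancherelMeasure (G : Type*) [Group G] : Measure (UnitaryDual G) :=
  Measure.sum fun Λ : UnitaryDual G =>
    (((Λ.dim : ℕ) : ENNReal) ^ 2 / (Nat.card G : ENNReal)) • Measure.dirac Λ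

/-- The one point compactification `{1, 2, …} ∪ {∞}` carries its Borel `σ`-algebra. -/
instance : MeasurableSpace (OnePoint ℕ+) := borel _

instance : BorelSpace (OnePoint ℕ+) := ⟨rfl⟩

/-- The image of the Plancherel measure under `Λ ↦ dim Λ`, viewed as a measure on
`{1, 2, …} ∪ {∞}`. -/
def plancherelDimMeasure (G : Type*) [Group G] : Measure (OnePoint ℕ+) :=
  (plancherelMeasure G).map fun Λ => (Λ.dim : OnePoint ℕ+)

/-- Weak convergence of a sequence of measures: convergence of the integrals of all bounded
continuous functions. -/
def ConvergesWeakly {S : Type*} [TopologicalSpace S] [MeasurableSpace S]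
    (ν : ℕ → Measure S) (ν' : Measure S) : Prop :=
  ∀ f : BoundedContinuousFunction S ℝ,
    Tendsto (fun N => ∫ x, f x ∂(ν N)) atTop (𝓝 (∫ x, f x ∂ν'))

end Plancherel

section FreeProbability

/-- `φ` is a state on the unital C⋆-algebra `A`, i.e. `(A, φ)` is a C⋆-probability space. -/
structure IsState {A : Type*} [CStarAlgebra A] (φ : A →ₗ[ℂ] ℂ) : Prop where
  map_one : φ 1 = 1
  map_star : ∀ a, φ (star a) = star (φ a)
  nonneg : ∀ a, 0 ≤ (φ (a * star a)).re

/-- Freeness of a family of unital subalgebras: every alternating product of centred elements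
is centred. -/
def FreeSubalgebras {A : Type*} [Ring A] [Algebra ℂ A] (φ : A →ₗ[ℂ] ℂ) {ι : Type*}
    (S : ι → Subalgebra ℂ A) : Prop :=
  ∀ (n : ℕ) (i : Fin (n + 1) → ι) (a : Fin (n + 1) → A),
    (∀ k : Fin n, i k.castSucc ≠ i k.succ) →
    (∀ k, a k ∈ S (i k)) → (∀ k, φ (a k) = 0) →
    φ (List.ofFn a).prod = 0

/-- A family of subsets is free if the unital subalgebras that they generate are free. -/
def FreeSubsets {A : Type*} [Ring A] [Algebra ℂ A] (φ : A →ₗ[ℂ] ℂ) {ι : Type*}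
    (s : ι → Set A) : Prop :=
  FreeSubalgebras φ fun i => Algebra.adjoin ℂ (s i)

/-- A semicircular element: self-adjoint, with vanishing odd moments and with the Catalan numbers
as even moments. -/
structure IsSemicircular {A : Type*} [CStarAlgebra A] (φ : A →ₗ[ℂ] ℂ) (a : A) : Prop where
  isSelfAdjoint : IsSelfAdjoint a
  odd_moments : ∀ k : ℕ, φ (a ^ (2 * k + 1)) = 0
  even_moments : ∀ k : ℕ, φ (a ^ (2 * k)) = (catalan k : ℂ)

/-- A circular element: `(a + i b) / √2` with `a`, `b` free semicircular elements. -/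
def IsCircular {A : Type*} [CStarAlgebra A] (φ : A →ₗ[ℂ] ℂ) (c : A) : Prop :=
  ∃ a b : A, IsSemicircular φ a ∧ IsSemicircular φ b ∧
    FreeSubsets φ ![({a} : Set A), {b}] ∧
    c = ((Real.sqrt 2 : ℝ) : ℂ)⁻¹ • (a + Complex.I • b)

/-- `c₁, …, c_m` are circular and the sets `{c₁, c₁*}, …, {c_m, c_m*}` are free. -/
structure IsFreeCircularFamily {A : Type*} [CStarAlgebra A] (φ : A →ₗ[ℂ] ℂ) {m : ℕ}
    (c : Fin m → A) : Prop where
  isCircular : ∀ i, IsCircular φ (c i)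
  free : FreeSubsets φ fun i => {c i, star (c i)}

/-- The family consisting of all `a i` (at `(i, false)`) and all `(a i)*` (at `(i, true)`). -/
def withAdjoints {A ι : Type*} [Star A] (a : ι → A) : ι × Bool → A
  | (i, false) => a i
  | (i, true) => star (a i)

/-- Convergence in moments of the families `(a N i)_i` in the algebras `A N` with functionals
`φ N` to the family `(b i)_i` in the algebra `B` with the functional `ψ`: for every noncommutative
polynomial `Q`, `φ N (Q (a N)) → ψ (Q b)`. -/
def ConvergesInMoments {ι : Type*} {A : ℕ → Type*} [∀ N, Ring (A N)] [∀ N, Algebra ℂ (A N)]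
    (φ : ∀ N, A N → ℂ) (a : ∀ N, ι → A N)
    {B : Type*} [Ring B] [Algebra ℂ B] (ψ : B → ℂ) (b : ι → B) : Prop :=
  ∀ Q : FreeAlgebra ℂ ι,
    Tendsto (fun N => φ N (FreeAlgebra.lift ℂ (a N) Q)) atTop (𝓝 (ψ (FreeAlgebra.lift ℂ b Q)))

end FreeProbability

section Matrices

/-- The matrix, in the standard basis, of the convolution operator `v ↦ x * v` on `ℂ^G`. -/
def convMatrix {G : Type*} [Group G] (x : G → ℂ) : Matrix G G ℂ :=
  Matrix.of fun h g => x (h * g⁻¹)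

theorem convMatrix_mulVec {G : Type*} [Group G] [Fintype G] (x v : G → ℂ) (h : G) :
    (convMatrix x).mulVec v h = ∑ g, x (h * g⁻¹) * v g := rfl

/-- The random matrix `|G|^{-1/2} P_X` of a random function `X` on the finite group `G`, where
`X g : Ω → ℂ` is the value of the function at `g`. -/
def randomConvMatrix {G Ω : Type*} [Group G] (X : G → Ω → ℂ) : Ω → Matrix G G ℂ :=
  fun ω => ((Real.sqrt (Nat.card G) : ℝ) : ℂ)⁻¹ • convMatrix fun g => X g ω

/-- The functional `(1/n) 𝔼 tr` on random `n × n` matrices. -/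
def expectedTrace {Ω ι : Type*} [MeasurableSpace Ω] [Fintype ι] (P : Measure Ω)
    (M : Ω → Matrix ι ι ℂ) : ℂ :=
  (Fintype.card ι : ℂ)⁻¹ * ∫ ω, (M ω).trace ∂P

end Matrices

end

/-! Both sides are reduced to counting pairings. By translation invariance the normalized trace of a
word of length n is |G|^{-n/2} times the sum, over x_1, ..., x_n in G with x_1 ⋯ x_n = 1, of the
expectation of the product of the corresponding entries. Up to an error O(|G|^{-1/2}), only the
moments of ξ of order at most two matter: the expectation may be replaced by the number of pairings
of the factors that match each variable with its conjugate, as in the Wick formula for a complex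
Gaussian variable (`norm_prod_moment_sub_matchCount_le`, `wordSum_inv_card_keys_le`,
`wordSum_matchCount`).

Each pairing then contributes the probability that a word in independent uniform elements, each
occurring once together with its inverse, equals 1. If the pairing is noncrossing, the word cancels
and the probability is 1. If it has a crossing, the word has the form a y b x y⁻¹ c x⁻¹ d; for given
x the equation prescribes the conjugate of b x by y, so the probability is at most that of two
random elements commuting (`expect_crossing_le`, `abs_assignmentMean_sub_stackCount_le`).

The commuting probability is the number of conjugacy classes divided by |G|. Class functions are
detected by irreducible characters, so it is at most |Ĝ|/|G|, which is the integral of 1/d² against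
the image of the Plancherel measure. The function 1/d² is continuous and vanishes at ∞, so weak
convergence sends the commuting probability to 0 (`tendsto_commProb`).

It remains to see that the moments of free circular elements count noncrossing pairings. On the full
Fock space a circular element is l(e) + l(f)* with orthonormal e, f, and reading a word of such
operators on the vacuum pushes and pops letters of a stack (`inner_prod_eq_stackCount`). Freeness
determines joint moments (`FreeSubalgebras.moments_unique`), so this one model gives the moments of
every free circular family. -/

noncomputable section

/-! ### Representation theory: from the Plancherel measure to the commuting probability. -/

section DualCount

universe u

/-- An isomorphism of representations transfers irreducibility. -/
theorem Representation.Equiv.isIrreducible {k G V W : Type*} [Monoid G] [Field k]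
    [AddCommGroup V] [Module k V] [AddCommGroup W] [Module k W] {ρ : Representation k G V}
    {σ : Representation k G W} (e : ρ.Equiv σ) (h : ρ.IsIrreducible) : σ.IsIrreducible := by
  rw [Representation.irreducible_iff_isSimpleModule_asModule] at h ⊢
  exact IsSimpleModule.congr (LinearEquiv.ofBijective
    (Representation.IntertwiningMap.equivLinearMapAsModule ρ σ e.toIntertwiningMap)
    e.toLinearEquiv.bijective).symm

/-- An irreducible isometric representation is equivalent to a unitary matrix representation. -/
theorem exists_equiv_unitaryRep {G : Type*} [Group G] {W : Type*} [NormedAddCommGroup W]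
    [InnerProductSpace ℂ W] [FiniteDimensional ℂ W] (ρ : Representation ℂ G W)
    (hρ : ∀ g v, ‖ρ g v‖ = ‖v‖) (hirr : ρ.IsIrreducible) :
    ∃ (n : ℕ+) (σ : IrrUnitaryRep G n), Nonempty (ρ.Equiv (unitaryRep σ.1)) := by
  have hpos : 0 < Module.finrank ℂ W := by
    rw [Representation.irreducible_iff_isSimpleModule_asModule] at hirr
    have : Nontrivial W := hirr.nontrivial
    exact Module.finrank_pos
  let n : ℕ+ := ⟨Module.finrank ℂ W, hpos⟩
  let b : OrthonormalBasis (Fin n) ℂ W := stdOrthonormalBasis ℂ W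
  let τ : G →* Matrix (Fin n) (Fin n) ℂ :=
    (LinearMap.toMatrixAlgEquiv b.toBasis).toMulEquiv.toMonoidHom.comp ρ
  have hτ : ∀ g, τ g ∈ Matrix.unitaryGroup (Fin n) ℂ := by
    intro g
    let e : W ≃ₗᵢ[ℂ] W := LinearIsometryEquiv.ofSurjective ⟨ρ g, hρ g⟩
      (fun v => ⟨ρ g⁻¹ v, by simp⟩)
    -- The matrix of an isometry is the transition matrix between the orthonormal basis `b` and its
    -- image, hence unitary.
    have h1 : τ g = b.toBasis.toMatrix (b.map e).toBasis := by
      ext i j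
      simp [τ, Module.Basis.toMatrix_apply, LinearMap.toMatrixAlgEquiv_apply]
      rfl
    rw [h1]
    exact b.toMatrix_orthonormalBasis_mem_unitary (b.map e)
  let σ : G →* Matrix.unitaryGroup (Fin n) ℂ := τ.codRestrict _ hτ
  have e : ρ.Equiv (unitaryRep σ) := Representation.Equiv.mk b.toBasis.equivFun fun g => by
    refine LinearMap.ext fun v => ?_
    change b.toBasis.equivFun (ρ g v) = Matrix.toLin' (τ g) (b.toBasis.equivFun v)
    have := LinearMap.toMatrix_mulVec_repr b.toBasis b.toBasis (ρ g) v
    rw [Matrix.toLin'_apply]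
    exact this.symm
  exact ⟨n, ⟨σ, e.isIrreducible hirr⟩, ⟨e⟩⟩

/-- The action of the element `∑ f(g) g` of the group algebra. -/
def groupAlgebraAction {G W : Type*} [Group G] [Fintype G] [AddCommGroup W] [Module ℂ W]
    (ρ : Representation ℂ G W) (f : G → ℂ) : W →ₗ[ℂ] W := ∑ g, f g • ρ g

theorem groupAlgebraAction_apply {G W : Type*} [Group G] [Fintype G] [AddCommGroup W] [Module ℂ W]
    (ρ : Representation ℂ G W) (f : G → ℂ) (v : W) :
    groupAlgebraAction ρ f v = ∑ g, f g • ρ g v := by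
  simp [groupAlgebraAction]

/-- A class function orthogonal to all irreducible characters acts by zero on every isometric
representation. -/
theorem groupAlgebraAction_eq_zero {G : Type*} [Group G] [Fintype G] (f : G → ℂ)
    (hf : ∀ g h, f (h * g * h⁻¹) = f g)
    (h0 : ∀ (n : ℕ+) (σ : IrrUnitaryRep G n),
      LinearMap.trace ℂ _ (groupAlgebraAction (unitaryRep σ.1) f) = 0) (d : ℕ) :
    ∀ (W : Type u) [NormedAddCommGroup W] [InnerProductSpace ℂ W] [FiniteDimensional ℂ W]
      (ρ : Representation ℂ G W) (_ : ∀ g v, ‖ρ g v‖ = ‖v‖) (_ : Module.finrank ℂ W = d),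
      groupAlgebraAction ρ f = 0 := by
  induction d using Nat.strong_induction_on with
  | _ d ih =>
  intro W _ _ _ ρ hρ hd
  by_cases hirr : ρ.IsIrreducible
  · obtain ⟨n, σ, ⟨e⟩⟩ := exists_equiv_unitaryRep ρ hρ hirr
    have htr : LinearMap.trace ℂ W (groupAlgebraAction ρ f) = 0 := by
      rw [← h0 n σ, ← LinearMap.trace_conj' _ e.toLinearEquiv]
      congr 1
      ext1 v
      simp only [groupAlgebraAction, map_sum, map_smul]
      congr 1
      refine Finset.sum_congr rfl fun g _ => ?_
      congr 1
      exact Representation.Equiv.conj_apply_self g e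
    have hcomm : ∀ (g : G) (v : W),
        groupAlgebraAction ρ f (ρ g v) = ρ g (groupAlgebraAction ρ f v) := by
      intro g v
      simp only [groupAlgebraAction_apply, map_sum, map_smul]
      refine Fintype.sum_equiv (MulAut.conj g⁻¹).toEquiv _ _ fun x => ?_
      have h1 := hf x g⁻¹
      simp only [MulEquiv.toEquiv_eq_coe, MulEquiv.coe_toEquiv, MulAut.conj_apply]
      rw [h1, ← Module.End.mul_apply, ← map_mul, ← Module.End.mul_apply, ← map_mul]
      congr 3
      group
    have := hirr
    -- Schur's lemma: the action commutes with ρ because f is a class function, so it is a scalar c;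
    -- its trace c · dim W vanishes, hence so does c.
    obtain ⟨c, hc⟩ :=
      (Representation.IsIrreducible.algebraMap_intertwiningMap_bijective_of_isAlgClosed
        (ρ := ρ)).2 ((groupAlgebraAction ρ f).intertwiningMap_of_isIntertwiningMap ρ ρ hcomm)
    have hc' : groupAlgebraAction ρ f = c • LinearMap.id := by
      ext v
      exact (DFunLike.congr_fun hc v).symm
    rw [hc'] at htr ⊢
    rw [Representation.irreducible_iff_isSimpleModule_asModule] at hirr
    have : Nontrivial W := hirr.nontrivial
    have hne : (Module.finrank ℂ W : ℂ) ≠ 0 := Nat.cast_ne_zero.2 Module.finrank_pos.ne'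
    simp only [map_smul, LinearMap.trace_id, smul_eq_mul, mul_eq_zero, hne, or_false] at htr
    simp [htr]
  · by_cases hW : Subsingleton W
    · ext v; exact Subsingleton.elim _ _
    rw [not_subsingleton_iff_nontrivial] at hW
    have hex : ∃ S : Subrepresentation ρ, S.toSubmodule ≠ ⊥ ∧ S.toSubmodule ≠ ⊤ := by
      by_contra! hcon
      apply hirr
      have hnt : Nontrivial (Subrepresentation ρ) := by
        refine ⟨⊥, ⊤, fun h => ?_⟩
        exact bot_ne_top (α := Submodule ℂ W) (congrArg Subrepresentation.toSubmodule h)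
      refine { eq_bot_or_eq_top := fun S => ?_ }
      by_cases h : S.toSubmodule = ⊥
      · exact Or.inl (Subrepresentation.toSubmodule_injective h)
      · exact Or.inr (Subrepresentation.toSubmodule_injective (hcon S h))
    obtain ⟨S, hS0, hS1⟩ := hex
    have hsub : ∀ T : Subrepresentation ρ, T.toSubmodule ≠ ⊤ → ∀ v ∈ T.toSubmodule,
        groupAlgebraAction ρ f v = 0 := by
      intro T hT v hv
      have hlt := Submodule.finrank_lt hT
      have h := ih _ (hd ▸ hlt) T.toSubmodule T.toRepresentation
        (fun g v => hρ g v) rfl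
      have h2 := congrArg Subtype.val (LinearMap.congr_fun h ⟨v, hv⟩)
      rw [groupAlgebraAction_apply] at h2 ⊢
      simp only [AddSubmonoidClass.coe_finsetSum, SetLike.val_smul] at h2
      exact h2
    have hinner : ∀ g v w, inner ℂ (ρ g v) (ρ g w) = inner ℂ v w := fun g v w =>
      LinearIsometry.inner_map_map (⟨ρ g, hρ g⟩ : W →ₗᵢ[ℂ] W) v w
    -- Isometries preserve the orthogonal complement. Both summands are proper, hence of smaller
    -- dimension, and the induction hypothesis applies to each.
    let T : Subrepresentation ρ := ⟨S.toSubmoduleᗮ, fun g v hv => by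
      rw [Submodule.mem_orthogonal] at hv ⊢
      intro u hu
      have := hinner g (ρ g⁻¹ u) v
      rw [Representation.self_inv_apply] at this
      rw [this]
      exact hv _ (S.apply_mem_toSubmodule g⁻¹ hu)⟩
    have hT : T.toSubmodule ≠ ⊤ := by
      intro h
      exact hS0 ((Submodule.orthogonal_eq_top_iff _).1 h)
    ext v
    obtain ⟨y, hy, z, hz, rfl⟩ := S.toSubmodule.exists_add_mem_mem_orthogonal v
    rw [map_add, hsub S hS1 y hy, hsub T hT z hz]
    simp

/-- The left regular representation on `ℓ²(G)`. -/
def regularRep (G : Type*) [Group G] [Fintype G] :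
    Representation ℂ G (EuclideanSpace ℂ G) where
  toFun g := (LinearIsometryEquiv.piLpCongrLeft 2 ℂ ℂ (Equiv.mulLeft g)).toLinearEquiv.toLinearMap
  map_one' := by
    ext v i
    change v ((1 : G)⁻¹ * i) = v i
    simp
  map_mul' g h := by
    ext v i
    change v ((g * h)⁻¹ * i) = v (h⁻¹ * (g⁻¹ * i))
    rw [mul_inv_rev, mul_assoc]

/-- In the regular representation the action of f sends the delta function at 1 to f itself, so f
vanishes as soon as it acts by zero there. -/
theorem eq_zero_of_trace_eq_zero {G : Type*} [Group G] [Fintype G] (f : G → ℂ)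
    (hf : ∀ g h, f (h * g * h⁻¹) = f g)
    (h0 : ∀ (n : ℕ+) (σ : IrrUnitaryRep G n),
      LinearMap.trace ℂ _ (groupAlgebraAction (unitaryRep σ.1) f) = 0) : f = 0 := by
  classical
  have h := groupAlgebraAction_eq_zero f hf h0 _ (EuclideanSpace ℂ G) (regularRep G)
    (fun g v => (LinearIsometryEquiv.piLpCongrLeft 2 ℂ ℂ (Equiv.mulLeft g)).norm_map v) rfl
  ext x
  have h1 := congrArg (fun w : EuclideanSpace ℂ G => w x)
    (LinearMap.congr_fun h (EuclideanSpace.single 1 1))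
  rw [groupAlgebraAction_apply] at h1
  simpa [regularRep, LinearIsometryEquiv.piLpCongrLeft_single, Pi.single_apply] using h1

/-- Completeness of irreducible characters makes the map from class functions to their traces on all
irreducible classes injective; compare dimensions. -/
theorem card_conjClasses_le (G : Type*) [Group G] [Fintype G] [Finite (UnitaryDual G)] :
    Nat.card (ConjClasses G) ≤ Nat.card (UnitaryDual G) := by
  classical
  have := Fintype.ofFinite (UnitaryDual G)
  let rep : ∀ Λ : UnitaryDual G, IrrUnitaryRep G Λ.1 := fun Λ => Quotient.out Λ.2
  let L : (ConjClasses G → ℂ) →ₗ[ℂ] (UnitaryDual G → ℂ) :=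
    { toFun := fun f Λ => LinearMap.trace ℂ _
        (groupAlgebraAction (unitaryRep (rep Λ).1) fun g => f (ConjClasses.mk g))
      map_add' := fun f f' => by
        ext Λ
        simp [groupAlgebraAction, add_smul, Finset.sum_add_distrib]
      map_smul' := fun c f => by
        ext Λ
        simp [groupAlgebraAction, mul_smul, Finset.mul_sum] }
  have hL : Function.Injective L := by
    rw [← LinearMap.ker_eq_bot, LinearMap.ker_eq_bot']
    intro f hf
    have h := eq_zero_of_trace_eq_zero (fun g => f (ConjClasses.mk g))
      (fun g h => by
        congr 1
        exact ConjClasses.mk_eq_mk_iff_isConj.2 (isConj_iff.2 ⟨h, rfl⟩).symm) ?_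
    · ext x
      obtain ⟨g, rfl⟩ := ConjClasses.exists_rep x
      exact congrFun h g
    -- The kernel of `L` only controls the chosen representative of each class; the trace is
    -- invariant under equivalence.
    intro n σ
    have h1 := congrFun hf (⟨n, Quotient.mk _ σ⟩ : UnitaryDual G)
    have h2 : Nonempty ((unitaryRep (Quotient.out (Quotient.mk (irrUnitaryRepSetoid G n) σ)).1).Equiv
        (unitaryRep σ.1)) :=
      Quotient.exact (Quotient.out_eq (Quotient.mk (irrUnitaryRepSetoid G n) σ))
    obtain ⟨e⟩ := h2
    refine Eq.trans ?_ h1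
    change _ = LinearMap.trace ℂ _ (groupAlgebraAction
      (unitaryRep (Quotient.out (Quotient.mk (irrUnitaryRepSetoid G n) σ)).1) _)
    refine Eq.trans ?_ (LinearMap.trace_conj' _ e.toLinearEquiv)
    congr 1
    simp only [groupAlgebraAction, map_sum, map_smul]
    refine Finset.sum_congr rfl fun g _ => ?_
    congr 1
    exact (Representation.Equiv.conj_apply_self g e).symm
  have := LinearMap.finrank_le_finrank_of_injective hL
  simpa [Nat.card_eq_fintype_card] using this

theorem integral_plancherelDimMeasure {G : Type*} [Group G] [Finite (UnitaryDual G)] [Finite G]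
    (f : BoundedContinuousFunction (OnePoint ℕ+) ℝ) :
    ∫ x, f x ∂plancherelDimMeasure G =
      ∑ᶠ Λ : UnitaryDual G, ((Λ.dim : ℕ) : ℝ) ^ 2 / Nat.card G * f (Λ.dim : OnePoint ℕ+) := by
  have := Fintype.ofFinite (UnitaryDual G)
  have hmeas : Measurable fun Λ : UnitaryDual G => (Λ.dim : OnePoint ℕ+) := measurable_from_top
  have hne : (Nat.card G : ENNReal) ≠ 0 := Nat.cast_ne_zero.2 Nat.card_pos.ne'
  rw [plancherelDimMeasure, integral_map hmeas.aemeasurable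
    f.continuous.measurable.aestronglyMeasurable, plancherelMeasure, Measure.sum_fintype,
    integral_finsetSum_measure, finsum_eq_sum_of_fintype]
  · refine Finset.sum_congr rfl fun Λ _ => ?_
    rw [integral_smul_measure, integral_dirac]
    simp
  · intro Λ _
    refine Integrable.smul_measure ?_ ?_
    · exact integrable_dirac (by simp)
    · exact ENNReal.div_ne_top (by simp) hne

/-- Every class has mass at least 1/|G|, so an infinite dual would have infinite total mass, for
which the Bochner integral of 1 is 0 by convention. This way finiteness of the dual comes from the
weak convergence itself. -/
theorem finite_unitaryDual_of_integral_ne_zero {G : Type*} [Group G] [Finite G]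
    (h : ∫ _, (1 : ℝ) ∂plancherelDimMeasure G ≠ 0) : Finite (UnitaryDual G) := by
  by_contra hinf
  rw [not_finite_iff_infinite] at hinf
  apply h
  have hmeas : Measurable fun Λ : UnitaryDual G => (Λ.dim : OnePoint ℕ+) := measurable_from_top
  have htop : plancherelDimMeasure G Set.univ = ⊤ := by
    rw [plancherelDimMeasure, Measure.map_apply hmeas MeasurableSet.univ, plancherelMeasure,
      Measure.sum_apply _ (hmeas MeasurableSet.univ)]
    refine top_unique ?_
    calc (⊤ : ENNReal) = ∑' _ : UnitaryDual G, (Nat.card G : ENNReal)⁻¹ :=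
          (ENNReal.tsum_const_eq_top_of_ne_zero (by simp)).symm
      _ ≤ _ := by
          refine ENNReal.tsum_le_tsum fun Λ => ?_
          simp only [Set.preimage_univ, Measure.smul_apply, measure_univ, smul_eq_mul, mul_one]
          rw [div_eq_mul_inv]
          refine le_mul_of_one_le_left (by simp) ?_
          exact_mod_cast Nat.one_le_pow _ _ Λ.dim.pos
  simp [Measure.real, htop]

/-- The bounded continuous function `d ↦ 1 / d²` on `{1, 2, …} ∪ {∞}`. -/
def invSqDim : BoundedContinuousFunction (OnePoint ℕ+) ℝ :=
  BoundedContinuousFunction.mkOfCompact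
    ⟨fun x => x.elim (0 : ℝ) (fun d : ℕ+ => ((d : ℕ) : ℝ)⁻¹ ^ 2), by
      rw [OnePoint.continuous_iff_from_discrete]
      simp only [OnePoint.elim_infty, OnePoint.elim_some]
      have h1 : Tendsto (fun d : ℕ+ => (d : ℕ)) cofinite atTop := by
        rw [← Nat.cofinite_eq_atTop]
        exact PNat.coe_injective.tendsto_cofinite
      have h2 := (tendsto_inv_atTop_zero (𝕜 := ℝ)).comp (tendsto_natCast_atTop_atTop.comp h1)
      simpa using h2.pow 2⟩

/-- Each class contributes (dim²/|G|) · dim⁻² = 1/|G|, so the integral is |Ĝ|/|G|. -/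
theorem commProb_le_integral {G : Type*} [Group G] [Fintype G] [Finite (UnitaryDual G)] :
    (commProb G : ℝ) ≤ ∫ x, invSqDim x ∂plancherelDimMeasure G := by
  have := Fintype.ofFinite (UnitaryDual G)
  rw [integral_plancherelDimMeasure, finsum_eq_sum_of_fintype, commProb_def']
  have h : ∀ Λ : UnitaryDual G,
      ((Λ.dim : ℕ) : ℝ) ^ 2 / Nat.card G * invSqDim (Λ.dim : OnePoint ℕ+) = (Nat.card G : ℝ)⁻¹ := by
    intro Λ
    have h1 : invSqDim (Λ.dim : OnePoint ℕ+) = ((Λ.dim : ℕ) : ℝ)⁻¹ ^ 2 := rfl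
    have h2 : ((Λ.dim : ℕ) : ℝ) ≠ 0 := Nat.cast_ne_zero.2 Λ.dim.pos.ne'
    rw [h1]
    field_simp
  rw [Finset.sum_congr rfl fun Λ _ => h Λ, Finset.sum_const, nsmul_eq_mul, Finset.card_univ,
    ← Nat.card_eq_fintype_card, ← div_eq_mul_inv]
  push_cast
  gcongr
  exact_mod_cast card_conjClasses_le G

/-- If the dimension of a Plancherel random representation tends to infinity, then the commuting
probability tends to zero. -/
theorem tendsto_commProb (G : ℕ → Type*) [∀ N, Group (G N)] [∀ N, Fintype (G N)]
    (h : ConvergesWeakly (fun N => plancherelDimMeasure (G N))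
      (Measure.dirac (OnePoint.infty : OnePoint ℕ+))) :
    Tendsto (fun N => (commProb (G N) : ℝ)) atTop (𝓝 0) := by
  have h1 := h (BoundedContinuousFunction.const _ 1)
  have h2 := h invSqDim
  have h3 : invSqDim OnePoint.infty = 0 := rfl
  rw [integral_dirac, h3] at h2
  simp only [BoundedContinuousFunction.const_apply, integral_dirac] at h1
  refine squeeze_zero' (Eventually.of_forall fun N => by exact_mod_cast (commProb_pos _).le) ?_ h2
  -- Testing against the constant 1 shows that the total masses are eventually nonzero, which yields
  -- finite duals.
  filter_upwards [h1.eventually_ne one_ne_zero] with N hN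
  have := finite_unitaryDual_of_integral_ne_zero hN
  exact commProb_le_integral

end DualCount

/-! ### Counting noncrossing pairings; ballot and Catalan numbers. -/

section StackCount

/-- The number of ways to read the word `w` letter by letter, starting from the stack `u` and ending
with the empty stack, where reading `p` either pushes `p` or pops `bar p`. With `u = []` this is the
number of noncrossing pairings of the letters of `w` that match `p` with `bar p` only. -/
def stackCount {P : Type*} [DecidableEq P] (bar : P → P) : List P → List P → ℕ
  | [], u => if u = [] then 1 else 0
  | p :: w, u => stackCount bar w (p :: u) +
      if u.head? = some (bar p) then stackCount bar w u.tail else 0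

/-- The number of nonnegative lattice paths with `n` steps `±1` from height `k` to height `0`. -/
def ballotCount : ℕ → ℕ → ℕ
  | 0, 0 => 1
  | 0, _ + 1 => 0
  | n + 1, 0 => ballotCount n 1
  | n + 1, k + 1 => ballotCount n (k + 2) + ballotCount n k

theorem stackCount_replicate (n : ℕ) : ∀ k : ℕ,
    stackCount (id : Unit → Unit) (List.replicate n ()) (List.replicate k ()) = ballotCount n k := by
  induction n with
  | zero => intro k; cases k <;> simp [stackCount, ballotCount]
  | succ n ih =>
    intro k
    cases k with
    | zero => simpa [List.replicate_succ (n := n), stackCount, ballotCount] using ih 1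
    | succ k =>
      have h := ih (k + 2)
      rw [List.replicate_succ] at h
      simp [List.replicate_succ, stackCount, ballotCount, ← ih k, ← h]

theorem ballotCount_of_lt (n : ℕ) : ∀ k, n < k → ballotCount n k = 0 := by
  induction n with
  | zero => intro k hk; cases k with
    | zero => omega
    | succ k => rfl
  | succ n ih => intro k hk; cases k with
    | zero => omega
    | succ k => rw [ballotCount, ih _ (by omega), ih _ (by omega)]

theorem ballotCount_self (n : ℕ) : ballotCount n n = 1 := by
  induction n with
  | zero => rfl
  | succ n ih => rw [ballotCount, ih, ballotCount_of_lt _ _ (by omega)]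

theorem ballotCount_of_odd (n : ℕ) : ∀ k, Odd (n + k) → ballotCount n k = 0 := by
  induction n with
  | zero => intro k hk; cases k with
    | zero => simp at hk
    | succ k => rfl
  | succ n ih => intro k hk; cases k with
    | zero => exact ih 1 (by simpa using hk)
    | succ k =>
      rw [ballotCount, ih _ (by grind), ih _ (by grind)]

/-- The reflection principle: a path from k to 0 has j + 1 up-steps, and among the `n.choose (j +
1)` unrestricted paths those that go below 0 number `n.choose j`. Paths with no up-step are left to
`ballotCount_self`. -/
theorem ballotCount_add_choose (n : ℕ) : ∀ k j, n = k + 2 * (j + 1) →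
    ballotCount n k + n.choose j = n.choose (j + 1) := by
  induction n with
  | zero => intro k j h; omega
  | succ n ih =>
    intro k j h
    rcases k with _ | k <;> rcases j with _ | j
    · obtain rfl : n = 1 := by omega
      decide
    · have h1 := ih 1 j (by omega)
      -- At height 0 only an up-step is allowed; here n = 2j + 3, and the symmetry of the middle
      -- binomial coefficients makes up for the missing term of Pascal's rule.
      have h2 : n.choose (j + 2) = n.choose (j + 1) := Nat.choose_symm_of_eq_add (by omega)
      rw [ballotCount, Nat.choose_succ_succ' n j, Nat.choose_succ_succ' n (j + 1), h2]
      omega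
    · have h1 := ih k 0 (by omega)
      obtain rfl : n = k + 2 := by omega
      rw [ballotCount, ballotCount_self, Nat.choose_succ_succ']
      simp only [Nat.choose_zero_right] at h1 ⊢
      omega
    · have h1 := ih (k + 2) j (by omega)
      have h2 := ih k (j + 1) (by omega)
      rw [ballotCount, Nat.choose_succ_succ' n j, Nat.choose_succ_succ' n (j + 1)]
      omega

theorem ballotCount_two_mul (j : ℕ) : ballotCount (2 * j) 0 = catalan j := by
  rcases j with _ | j
  · simp [ballotCount]
  have h1 := ballotCount_add_choose (2 * (j + 1)) 0 j (by ring)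
  have h2 := succ_mul_catalan_eq_centralBinom (j + 1)
  rw [Nat.centralBinom] at h2
  have h3 := Nat.choose_succ_right_eq (2 * (j + 1)) j
  rw [show 2 * (j + 1) - j = j + 2 by omega] at h3
  apply Nat.eq_of_mul_eq_mul_left (show 0 < j + 1 + 1 by omega)
  rw [h2]
  nlinarith

end StackCount

/-! ### Freeness determines joint moments. -/

section FreeUniqueness

theorem FreeAlgebra.mem_span_words {X : Type*} (Q : FreeAlgebra ℂ X) :
    Q ∈ Submodule.span ℂ (Set.range fun l : List X => (l.map (FreeAlgebra.ι ℂ)).prod) := by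
  induction Q using FreeAlgebra.induction with
  | grade0 r =>
    rw [Algebra.algebraMap_eq_smul_one]
    exact Submodule.smul_mem _ _ (Submodule.subset_span ⟨[], by simp⟩)
  | grade1 x => exact Submodule.subset_span ⟨[x], by simp⟩
  | mul a b ha hb =>
    have h := Submodule.mul_mem_mul ha hb
    rw [Submodule.span_mul_span] at h
    refine Submodule.span_mono ?_ h
    rintro _ ⟨_, ⟨l, rfl⟩, _, ⟨l', rfl⟩, rfl⟩
    exact ⟨l ++ l', by simp⟩
  | add a b ha hb => exact Submodule.add_mem _ ha hb

/-- Induction on noncommutative polynomials as linear combinations of words. -/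
theorem FreeAlgebra.word_induction {X : Type*} {p : FreeAlgebra ℂ X → Prop}
    (add : ∀ a b, p a → p b → p (a + b)) (smul : ∀ (r : ℂ) a, p a → p (r • a))
    (word : ∀ l : List X, p (l.map (FreeAlgebra.ι ℂ)).prod) (Q : FreeAlgebra ℂ X) : p Q := by
  refine Submodule.span_induction (p := fun x _ => p x) ?_ ?_ (fun a b _ _ => add a b)
    (fun r a _ => smul r a) (FreeAlgebra.mem_span_words Q)
  · rintro _ ⟨l, rfl⟩
    exact word l
  · simpa using smul 0 _ (word [])

theorem FreeAlgebra.lift_word {X A : Type*} [Ring A] [Algebra ℂ A] (f : X → A) (l : List X) :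
    FreeAlgebra.lift ℂ f (l.map (FreeAlgebra.ι ℂ)).prod = (l.map f).prod := by
  rw [map_list_prod, List.map_map]
  congr 1
  exact List.map_congr_left fun x _ => FreeAlgebra.lift_ι_apply f x

/-- Double induction on the length of the product and on the number of factors that are not centred.
Neighbours from the same subalgebra are merged; a factor that is not centred is split into a centred
one and a scalar; an alternating product of centred factors vanishes on both sides. The algebra `R`
of abstract polynomials lets both families undergo the same manipulations. -/
theorem FreeSubalgebras.moments_unique {ι R A A' : Type*} [Ring R] [Algebra ℂ R]
    [Ring A] [Algebra ℂ A] [Ring A'] [Algebra ℂ A'] {φ : A →ₗ[ℂ] ℂ} {φ' : A' →ₗ[ℂ] ℂ}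
    (hφ : φ 1 = 1) (hφ' : φ' 1 = 1) {S : ι → Subalgebra ℂ A} {S' : ι → Subalgebra ℂ A'}
    (hS : FreeSubalgebras φ S) (hS' : FreeSubalgebras φ' S')
    (α : ι → R →ₐ[ℂ] A) (α' : ι → R →ₐ[ℂ] A') (hα : ∀ i r, α i r ∈ S i)
    (hα' : ∀ i r, α' i r ∈ S' i) (h : ∀ i r, φ (α i r) = φ' (α' i r)) (l : List (ι × R)) :
    φ (l.map fun p => α p.1 p.2).prod = φ' (l.map fun p => α' p.1 p.2).prod := by
  classical
  obtain ⟨n, hn⟩ : ∃ n, l.length = n := ⟨_, rfl⟩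
  induction n using Nat.strong_induction_on generalizing l with
  | _ n ihn =>
  obtain ⟨k, hk⟩ : ∃ k, l.countP (fun p => φ (α p.1 p.2) ≠ 0) = k := ⟨_, rfl⟩
  induction k using Nat.strong_induction_on generalizing l with
  | _ k ihk =>
  by_cases hch : l.IsChain fun p q => p.1 ≠ q.1
  · by_cases hc : ∃ p ∈ l, φ (α p.1 p.2) ≠ 0
    · obtain ⟨⟨i, r⟩, hp, hr⟩ := hc
      obtain ⟨l₁, l₂, rfl⟩ := List.append_of_mem hp
      set c := φ (α i r) with hcdef
      -- Centring keeps the length and lowers the number of uncentred factors; the scalar remainder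
      -- is a shorter product.
      have h0 : φ (α i (r - c • 1)) = 0 := by simp [hφ, ← hcdef]
      have h1 := ihk _ (by
        rw [← hk]
        simp only [List.countP_append, List.countP_cons, h0]
        simp [← hcdef, hr]) (l₁ ++ (i, r - c • 1) :: l₂) (by simpa using hn) rfl
      have h2 := ihn (l₁ ++ l₂).length (by rw [← hn]; simp) (l₁ ++ l₂) rfl
      have e1 : (List.map (fun p => α p.1 p.2) (l₁ ++ (i, r) :: l₂)).prod =
          (List.map (fun p => α p.1 p.2) (l₁ ++ (i, r - c • 1) :: l₂)).prod +
          c • (List.map (fun p => α p.1 p.2) (l₁ ++ l₂)).prod := by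
        simp [sub_mul, mul_sub]
      have e2 : (List.map (fun p => α' p.1 p.2) (l₁ ++ (i, r) :: l₂)).prod =
          (List.map (fun p => α' p.1 p.2) (l₁ ++ (i, r - c • 1) :: l₂)).prod +
          c • (List.map (fun p => α' p.1 p.2) (l₁ ++ l₂)).prod := by
        simp [sub_mul, mul_sub]
      rw [e1, e2, map_add, map_add, map_smul, map_smul, h1, h2]
    · push Not at hc
      rcases n with _ | n
      · rw [List.length_eq_zero_iff] at hn
        simp [hn, hφ, hφ']
      · have hne : ∀ k : Fin n, (l.get (k.castSucc.cast hn.symm)).1 ≠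
            (l.get (k.succ.cast hn.symm)).1 := by
          intro k
          rw [List.isChain_iff_getElem] at hch
          exact hch k (by omega)
        have e1 : (l.map fun p => α p.1 p.2) =
            List.ofFn fun k : Fin (n + 1) => α (l.get (k.cast hn.symm)).1
              (l.get (k.cast hn.symm)).2 := by
          apply List.ext_get (by simp [hn])
          intro k _ _
          simp [-List.ofFn_succ]
        have e2 : (l.map fun p => α' p.1 p.2) =
            List.ofFn fun k : Fin (n + 1) => α' (l.get (k.cast hn.symm)).1
              (l.get (k.cast hn.symm)).2 := by
          apply List.ext_get (by simp [hn])
          intro k _ _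
          simp [-List.ofFn_succ]
        rw [e1, e2, hS n _ _ hne (fun k => hα _ _) (fun k => hc _ (List.get_mem _ _)),
          hS' n _ _ hne (fun k => hα' _ _)
            (fun k => (h _ _).symm.trans (hc _ (List.get_mem _ _)))]
  · rw [List.isChain_iff_forall_rel_of_append_cons_cons] at hch
    push Not at hch
    obtain ⟨⟨i, r⟩, ⟨j, s⟩, l₁, l₂, rfl, hij⟩ := hch
    obtain rfl : i = j := hij
    have := ihn (l₁ ++ (i, r * s) :: l₂).length (by rw [← hn]; simp) _ rfl
    simpa [mul_assoc] using this

theorem IsSemicircular.apply_aeval_eq {A A' : Type*} [CStarAlgebra A] [CStarAlgebra A']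
    {φ : A →ₗ[ℂ] ℂ} {φ' : A' →ₗ[ℂ] ℂ} {a : A} {a' : A'} (h : IsSemicircular φ a)
    (h' : IsSemicircular φ' a') (p : Polynomial ℂ) :
    φ (Polynomial.aeval a p) = φ' (Polynomial.aeval a' p) := by
  have hpow : ∀ n, φ (a ^ n) = φ' (a' ^ n) := by
    intro n
    obtain ⟨k, rfl | rfl⟩ := n.even_or_odd'
    · rw [h.even_moments, h'.even_moments]
    · rw [h.odd_moments, h'.odd_moments]
  simp [Polynomial.aeval_eq_sum_range, hpow]

theorem FreeSubsets.semicircular_moments_unique {A A' : Type*} [CStarAlgebra A] [CStarAlgebra A']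
    {φ : A →ₗ[ℂ] ℂ} {φ' : A' →ₗ[ℂ] ℂ} (hφ : φ 1 = 1) (hφ' : φ' 1 = 1) {ι : Type*}
    {a : ι → A} {a' : ι → A'} (ha : ∀ i, IsSemicircular φ (a i))
    (ha' : ∀ i, IsSemicircular φ' (a' i)) (h : FreeSubsets φ fun i => {a i})
    (h' : FreeSubsets φ' fun i => {a' i}) (Q : FreeAlgebra ℂ ι) :
    φ (FreeAlgebra.lift ℂ a Q) = φ' (FreeAlgebra.lift ℂ a' Q) := by
  induction Q using FreeAlgebra.word_induction with
  | add x y hx hy => simp [hx, hy]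
  | smul r x hx => simp [hx]
  | word l =>
    have := FreeSubalgebras.moments_unique hφ hφ' h h' (fun i => Polynomial.aeval (a i))
      (fun i => Polynomial.aeval (a' i)) (fun i r => Polynomial.aeval_mem_adjoin_singleton _ _)
      (fun i r => Polynomial.aeval_mem_adjoin_singleton _ _)
      (fun i r => (ha i).apply_aeval_eq (ha' i) r) (l.map fun i => (i, Polynomial.X))
    rw [FreeAlgebra.lift_word, FreeAlgebra.lift_word]
    simpa [Function.comp_def] using this

theorem cons_singleton_eq {A : Type*} (a b : A) :
    (![({a} : Set A), {b}]) = fun i => {![a, b] i} := by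
  ext1 i
  fin_cases i <;> rfl

/-- The expression of a circular element and its adjoint through two semicircular elements. -/
def circularSubst : FreeAlgebra ℂ Bool →ₐ[ℂ] FreeAlgebra ℂ (Fin 2) :=
  FreeAlgebra.lift ℂ fun e => ((Real.sqrt 2 : ℝ) : ℂ)⁻¹ •
    (FreeAlgebra.ι ℂ 0 + (cond e (-Complex.I) Complex.I) • FreeAlgebra.ι ℂ 1)

/-- A polynomial in c and c* is a polynomial in a and b that does not depend on the realization,
which reduces circular moments to semicircular ones. -/
theorem lift_circularSubst {A : Type*} [CStarAlgebra A] {a b c : A} (ha : IsSelfAdjoint a)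
    (hb : IsSelfAdjoint b) (hc : c = ((Real.sqrt 2 : ℝ) : ℂ)⁻¹ • (a + Complex.I • b)) :
    FreeAlgebra.lift ℂ (fun e => cond e (star c) c) =
      (FreeAlgebra.lift ℂ ![a, b]).comp circularSubst := by
  ext e
  cases e <;> simp [circularSubst, ha.star_eq, hb.star_eq, hc]

theorem IsCircular.moments_unique {A A' : Type*} [CStarAlgebra A] [CStarAlgebra A']
    {φ : A →ₗ[ℂ] ℂ} {φ' : A' →ₗ[ℂ] ℂ} (hφ : φ 1 = 1) (hφ' : φ' 1 = 1) {c : A} {c' : A'}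
    (h : IsCircular φ c) (h' : IsCircular φ' c') (Q : FreeAlgebra ℂ Bool) :
    φ (FreeAlgebra.lift ℂ (fun e => cond e (star c) c) Q) =
      φ' (FreeAlgebra.lift ℂ (fun e => cond e (star c') c') Q) := by
  obtain ⟨a, b, ha, hb, hab, hc⟩ := h
  obtain ⟨a', b', ha', hb', hab', hc'⟩ := h'
  rw [lift_circularSubst ha.isSelfAdjoint hb.isSelfAdjoint hc,
    lift_circularSubst ha'.isSelfAdjoint hb'.isSelfAdjoint hc']
  rw [cons_singleton_eq] at hab hab'
  refine FreeSubsets.semicircular_moments_unique hφ hφ' ?_ ?_ hab hab' _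
  · intro i; fin_cases i <;> assumption
  · intro i; fin_cases i <;> assumption

theorem lift_mem_adjoin {A : Type*} [CStarAlgebra A] (c : A) (Q : FreeAlgebra ℂ Bool) :
    FreeAlgebra.lift ℂ (fun e => cond e (star c) c) Q ∈ Algebra.adjoin ℂ {c, star c} := by
  induction Q using FreeAlgebra.induction with
  | grade0 r => simp
  | grade1 e =>
    rw [FreeAlgebra.lift_ι_apply]
    exact Algebra.subset_adjoin (by cases e <;> simp)
  | mul a b ha hb => rw [map_mul]; exact Subalgebra.mul_mem _ ha hb
  | add a b ha hb => rw [map_add]; exact Subalgebra.add_mem _ ha hb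

theorem withAdjoints_eq {A ι : Type*} [Star A] (a : ι → A) :
    withAdjoints a = fun p => cond p.2 (star (a p.1)) (a p.1) := by
  ext1 ⟨i, e⟩
  cases e <;> rfl

/-- The joint `⋆`-moments of free circular elements do not depend on their realization. -/
theorem IsFreeCircularFamily.moments_unique {A A' : Type*} [CStarAlgebra A] [CStarAlgebra A']
    {φ : A →ₗ[ℂ] ℂ} {φ' : A' →ₗ[ℂ] ℂ} (hφ : φ 1 = 1) (hφ' : φ' 1 = 1) {m : ℕ} {c : Fin m → A}
    {c' : Fin m → A'} (h : IsFreeCircularFamily φ c) (h' : IsFreeCircularFamily φ' c')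
    (l : List (Fin m × Bool)) :
    φ (l.map (withAdjoints c)).prod = φ' (l.map (withAdjoints c')).prod := by
  have := FreeSubalgebras.moments_unique hφ hφ' h.free h'.free
    (fun i => FreeAlgebra.lift ℂ (fun e => cond e (star (c i)) (c i)))
    (fun i => FreeAlgebra.lift ℂ (fun e => cond e (star (c' i)) (c' i)))
    (fun i => lift_mem_adjoin (c i)) (fun i => lift_mem_adjoin (c' i))
    (fun i => (h.isCircular i).moments_unique hφ hφ' (h'.isCircular i))
    (l.map fun p => (p.1, FreeAlgebra.ι ℂ p.2))
  simpa [Function.comp_def, withAdjoints_eq] using this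

end FreeUniqueness

/-! ### Free circular elements on the full Fock space and their moments. -/

section Fock

/-- The full Fock space over `ℓ²(L)`. -/
abbrev FockSpace (L : Type*) : Type _ := lp (fun _ : List L => ℂ) 2

/-- The standard basis of the Fock space, indexed by words. -/
def fockBasis (L : Type*) : HilbertBasis (List L) ℂ (FockSpace L) :=
  HilbertBasis.ofRepr (LinearIsometryEquiv.refl ℂ _)

/-- The isometry of the Fock space induced by an injective map of words. -/
def wordIsometry {L : Type*} (f : List L → List L) (hf : Function.Injective f) :
    FockSpace L →ₗᵢ[ℂ] FockSpace L :=
  ((fockBasis L).orthonormal.comp f hf).orthogonalFamily.linearIsometry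

theorem wordIsometry_apply {L : Type*} (f : List L → List L) (hf : Function.Injective f)
    (w : List L) : wordIsometry f hf (fockBasis L w) = fockBasis L (f w) := by
  classical
  have h : fockBasis L w = lp.single 2 w (1 : ℂ) := by
    rw [← HilbertBasis.repr_symm_single]
    rfl
  rw [h, wordIsometry, OrthogonalFamily.linearIsometry_apply_single]
  simp

theorem fockBasis_inner {L : Type*} [DecidableEq L] (u v : List L) :
    inner ℂ (fockBasis L u) (fockBasis L v) = if u = v then 1 else 0 :=
  orthonormal_iff_ite.1 (fockBasis L).orthonormal u v

theorem fock_ext {L : Type*} {x y : FockSpace L}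
    (h : ∀ u, inner ℂ (fockBasis L u) x = inner ℂ (fockBasis L u) y) : x = y := by
  apply (fockBasis L).repr.injective
  ext u
  simp only [HilbertBasis.repr_apply_apply, h]

/-- The left creation operator of a letter. -/
def creation {L : Type*} (j : L) : FockSpace L →L[ℂ] FockSpace L :=
  (wordIsometry (fun w => j :: w) (List.cons_injective)).toContinuousLinearMap

theorem creation_apply {L : Type*} (j : L) (w : List L) :
    creation j (fockBasis L w) = fockBasis L (j :: w) :=
  wordIsometry_apply _ List.cons_injective w

theorem star_creation_apply_nil {L : Type*} (j : L) :
    star (creation j) (fockBasis L []) = 0 := by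
  classical
  apply fock_ext
  intro u
  rw [ContinuousLinearMap.star_eq_adjoint, ContinuousLinearMap.adjoint_inner_right, creation_apply,
    fockBasis_inner]
  simp

theorem star_creation_apply_cons {L : Type*} [DecidableEq L] (j k : L) (w : List L) :
    star (creation j) (fockBasis L (k :: w)) = if j = k then fockBasis L w else 0 := by
  apply fock_ext
  intro u
  rw [ContinuousLinearMap.star_eq_adjoint, ContinuousLinearMap.adjoint_inner_right, creation_apply,
    fockBasis_inner]
  by_cases h : j = k <;> simp [h, fockBasis_inner]

theorem star_creation_mul_creation {L : Type*} [DecidableEq L] (j k : L) :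
    star (creation j) * creation k = if j = k then 1 else 0 := by
  refine ContinuousLinearMap.ext_on
    (Submodule.dense_iff_topologicalClosure_eq_top.2 (fockBasis L).dense_span) ?_
  rintro _ ⟨w, rfl⟩
  rw [mul_apply_eq_comp, creation_apply, star_creation_apply_cons]
  split_ifs <;> simp

/-- The vacuum state on the bounded operators of the Fock space. -/
def vacuumState (L : Type*) : (FockSpace L →L[ℂ] FockSpace L) →ₗ[ℂ] ℂ where
  toFun a := inner ℂ (fockBasis L []) (a (fockBasis L []))
  map_add' a b := by simp
  map_smul' c a := by simp

theorem vacuumState_apply {L : Type*} (a : FockSpace L →L[ℂ] FockSpace L) :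
    vacuumState L a = inner ℂ (fockBasis L []) (a (fockBasis L [])) := rfl

theorem vacuumState_isState (L : Type*) : IsState (vacuumState L) where
  map_one := by
    classical
    rw [vacuumState_apply, one_apply_eq_self, fockBasis_inner, if_pos rfl]
  map_star a := by
    rw [vacuumState_apply, vacuumState_apply, ContinuousLinearMap.star_eq_adjoint,
      ContinuousLinearMap.adjoint_inner_right]
    exact (inner_conj_symm _ _).symm
  nonneg a := by
    rw [vacuumState_apply, mul_apply_eq_comp, ← ContinuousLinearMap.adjoint_inner_left,
      ContinuousLinearMap.star_eq_adjoint]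
    exact inner_self_nonneg (𝕜 := ℂ)

/-- Vacuum moments of sums of creation and annihilation operators. -/
theorem inner_prod_eq_stackCount {H P : Type*} [NormedAddCommGroup H] [InnerProductSpace ℂ H]
    [CompleteSpace H] [DecidableEq P] {bar : P → P} (hbar : Function.Involutive bar)
    (l : P → H →L[ℂ] H) (hl : ∀ p q, star (l p) * l q = if p = q then 1 else 0) {Ω : H}
    (hΩ : inner ℂ Ω Ω = (1 : ℂ)) (hlΩ : ∀ p, star (l p) Ω = 0) (w : List P) :
    ∀ u : List P, inner ℂ ((u.map fun p => l (bar p)).prod Ω)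
      ((w.map fun p => l p + star (l (bar p))).prod Ω) = (stackCount bar w u : ℂ) := by
  induction w with
  | nil =>
    intro u
    rcases u with _ | ⟨q, u⟩
    · simpa [stackCount] using hΩ
    · rw [List.map_cons, List.prod_cons, mul_apply_eq_comp,
        ← ContinuousLinearMap.adjoint_inner_right, ← ContinuousLinearMap.star_eq_adjoint]
      simp [stackCount, hlΩ]
  | cons p w ih =>
    intro u
    -- The first operator is moved to the left argument, which is the basis vector encoding the
    -- stack u: creation pushes p, and annihilation pops the top letter q exactly when p = bar q.
    have hT : star (l p + star (l (bar p))) = l (bar p) + star (l p) := by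
      rw [star_add, star_star, add_comm]
    rw [List.map_cons, List.prod_cons, mul_apply_eq_comp,
      ← ContinuousLinearMap.adjoint_inner_left, ← ContinuousLinearMap.star_eq_adjoint, hT,
      add_apply, inner_add_left, stackCount, Nat.cast_add, ← ih (p :: u)]
    congr 1
    rcases u with _ | ⟨q, u⟩
    · simp [hlΩ]
    · rw [List.map_cons, List.prod_cons, ← mul_apply_eq_comp, ← mul_assoc, hl,
        List.head?_cons, List.tail_cons]
      have hiff : p = bar q ↔ some q = some (bar p) := by
        rw [Option.some_inj]
        constructor
        · rintro rfl; exact (hbar q).symm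
        · rintro rfl; exact (hbar p).symm
      by_cases h : p = bar q
      · rw [if_pos h, if_pos (hiff.1 h), one_mul, ih]
      · rw [if_neg h, if_neg (fun h' => h (hiff.2 h'))]
        simp

/-- With a single letter that is its own partner, stacks are heights, and the moments count Dyck
paths. -/
theorem isSemicircular_creation {L : Type*} (j : L) :
    IsSemicircular (vacuumState L) (creation j + star (creation j)) := by
  classical
  have h : ∀ n, vacuumState L ((creation j + star (creation j)) ^ n) = (ballotCount n 0 : ℂ) := by
    intro n
    have := inner_prod_eq_stackCount (bar := (id : Unit → Unit)) (fun _ => rfl)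
      (fun _ => creation j) (fun p q => by simp [star_creation_mul_creation])
      (Ω := fockBasis L []) (by rw [fockBasis_inner, if_pos rfl]) (fun _ => star_creation_apply_nil j)
      (List.replicate n ()) []
    rw [← stackCount_replicate n 0, List.replicate_zero, ← this, vacuumState_apply]
    simp
  refine ⟨IsSelfAdjoint.add_star_self _, fun k => ?_, fun k => ?_⟩
  · rw [h, ballotCount_of_odd _ _ (by simp)]
    simp
  · rw [h, ballotCount_two_mul]

/-- The span of the basis vectors of the words over `J`. -/
def wordSpan {L : Type*} (S : Set (List L)) : Submodule ℂ (FockSpace L) :=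
  Submodule.span ℂ (fockBasis L '' S)

/-- The isometry appending the word `w` on the right. -/
def appendWord {L : Type*} (w : List L) : FockSpace L →ₗᵢ[ℂ] FockSpace L :=
  wordIsometry (fun u => u ++ w) (List.append_left_injective w)

theorem appendWord_apply {L : Type*} (w u : List L) :
    appendWord w (fockBasis L u) = fockBasis L (u ++ w) := wordIsometry_apply _ _ u

/-- The words over `J`. -/
def wordsOver {L : Type*} (J : Set L) : Set (List L) := {u | ∀ x ∈ u, x ∈ J}

/-- The operators acting only on the initial segment of a word formed by letters in `J`. -/
def letterSubalgebra {L : Type*} (J : Set L) : Subalgebra ℂ (FockSpace L →L[ℂ] FockSpace L) where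
  carrier := {a | ∀ x ∈ wordSpan (wordsOver J), a x ∈ wordSpan (wordsOver J) ∧
    ∀ w : List L, (∀ y ∈ w.head?, y ∉ J) → a (appendWord w x) = appendWord w (a x)}
  mul_mem' {a b} ha hb x hx := ⟨(ha _ (hb x hx).1).1, fun w hw => by
    rw [mul_apply_eq_comp, (hb x hx).2 w hw, (ha _ (hb x hx).1).2 w hw]
    rfl⟩
  add_mem' {a b} ha hb x hx := ⟨Submodule.add_mem _ (ha x hx).1 (hb x hx).1, fun w hw => by
    simp [(hb x hx).2 w hw, (ha x hx).2 w hw]⟩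
  algebraMap_mem' r x hx := by
    simp only [Algebra.algebraMap_eq_smul_one, smul_apply,
      one_apply_eq_self, map_smul]
    exact ⟨Submodule.smul_mem _ r hx, fun _ _ => trivial⟩

theorem mem_letterSubalgebra {L : Type*} {J : Set L} {a : FockSpace L →L[ℂ] FockSpace L}
    (h : ∀ u ∈ wordsOver J, a (fockBasis L u) ∈ wordSpan (wordsOver J) ∧
      ∀ w : List L, (∀ y ∈ w.head?, y ∉ J) →
        a (fockBasis L (u ++ w)) = appendWord w (a (fockBasis L u))) :
    a ∈ letterSubalgebra J := by
  intro x hx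
  induction hx using Submodule.span_induction with
  | mem x hx =>
    obtain ⟨u, hu, rfl⟩ := hx
    refine ⟨(h u hu).1, fun w hw => ?_⟩
    rw [appendWord_apply, (h u hu).2 w hw]
  | zero => simp
  | add x y _ _ hx hy =>
    refine ⟨by rw [map_add]; exact Submodule.add_mem _ hx.1 hy.1, fun w hw => ?_⟩
    simp [hx.2 w hw, hy.2 w hw]
  | smul c x _ hx =>
    refine ⟨by rw [map_smul]; exact Submodule.smul_mem _ c hx.1, fun w hw => ?_⟩
    simp [hx.2 w hw]

theorem creation_mem_letterSubalgebra {L : Type*} {J : Set L} {j : L} (hj : j ∈ J) :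
    creation j ∈ letterSubalgebra J := by
  refine mem_letterSubalgebra fun u hu => ?_
  rw [creation_apply]
  refine ⟨Submodule.subset_span ⟨_, ?_, rfl⟩, fun w _ => ?_⟩
  · intro x hx
    rcases List.mem_cons.1 hx with rfl | hx
    · exact hj
    · exact hu x hx
  · rw [creation_apply, appendWord_apply]
    rfl

/-- The critical word is the empty one: annihilation kills the vacuum, and it also kills any w whose
first letter lies outside J. -/
theorem star_creation_mem_letterSubalgebra {L : Type*} {J : Set L} {j : L} (hj : j ∈ J) :
    star (creation j) ∈ letterSubalgebra J := by
  classical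
  refine mem_letterSubalgebra fun u hu => ?_
  rcases u with _ | ⟨k, u⟩
  · rw [star_creation_apply_nil]
    refine ⟨Submodule.zero_mem _, fun w hw => ?_⟩
    rcases w with _ | ⟨y, w⟩
    · simp [star_creation_apply_nil]
    · have : j ≠ y := fun h => hw y (by simp) (h ▸ hj)
      simp [star_creation_apply_cons, this]
  · rw [star_creation_apply_cons]
    refine ⟨?_, fun w _ => ?_⟩
    · split_ifs
      · exact Submodule.subset_span ⟨u, fun x hx => hu x (List.mem_cons_of_mem _ hx), rfl⟩
      · exact Submodule.zero_mem _
    · rw [List.cons_append, star_creation_apply_cons]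
      split_ifs <;> simp [appendWord_apply]

theorem mem_wordSpan_of_inner_eq_zero {L : Type*} {S : Set (List L)} {x : FockSpace L}
    (hx : x ∈ wordSpan S) (h : inner ℂ (fockBasis L []) x = 0) :
    x ∈ wordSpan {u | u ∈ S ∧ u ≠ []} := by
  classical
  have h1 : x ∈ Submodule.span ℂ
      (insert (fockBasis L []) (fockBasis L '' {u | u ∈ S ∧ u ≠ []})) := by
    refine Submodule.span_mono ?_ hx
    rintro _ ⟨u, hu, rfl⟩
    by_cases hn : u = []
    · exact Or.inl (by rw [hn])
    · exact Or.inr ⟨u, ⟨hu, hn⟩, rfl⟩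
  obtain ⟨c, y, hy, rfl⟩ := Submodule.mem_span_insert.1 h1
  have h2 : inner ℂ (fockBasis L []) y = 0 := by
    clear hx h h1
    induction hy using Submodule.span_induction with
    | mem y hy =>
      obtain ⟨u, ⟨_, hu⟩, rfl⟩ := hy
      rw [fockBasis_inner, if_neg (Ne.symm hu)]
    | zero => simp
    | add y z _ _ hy hz => rw [inner_add_right, hy, hz, add_zero]
    | smul c y _ hy => rw [inner_smul_right, hy, mul_zero]
  rw [inner_add_right, inner_smul_right, h2, fockBasis_inner, if_pos rfl] at h
  obtain rfl : c = 0 := by simpa using h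
  rw [zero_smul, zero_add]
  exact hy

/-- A centred operator turns the vacuum into a combination of nonempty words over its own letters.
The next factor has disjoint letters, so it sees such a word as the vacuum with an inert tail and
puts a nonempty word of its own in front. Thus the vacuum never reappears. -/
theorem prod_apply_vacuum_mem {L ι : Type*} {J : ι → Set L}
    (hJ : ∀ i j, i ≠ j → Disjoint (J i) (J j)) (n : ℕ) :
    ∀ (i : Fin (n + 1) → ι) (a : Fin (n + 1) → FockSpace L →L[ℂ] FockSpace L),
      (∀ k : Fin n, i k.castSucc ≠ i k.succ) → (∀ k, a k ∈ letterSubalgebra (J (i k))) →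
      (∀ k, vacuumState L (a k) = 0) →
      (List.ofFn a).prod (fockBasis L []) ∈ wordSpan {u | ∃ x ∈ J (i 0), u.head? = some x} := by
  have hvac : ∀ (j : ι) (a : FockSpace L →L[ℂ] FockSpace L), a ∈ letterSubalgebra (J j) →
      vacuumState L a = 0 →
      a (fockBasis L []) ∈ wordSpan {u | u ∈ wordsOver (J j) ∧ u ≠ []} := fun j a ha h0 =>
    mem_wordSpan_of_inner_eq_zero
      (ha _ (Submodule.subset_span ⟨[], by simp [wordsOver], rfl⟩)).1 h0
  have happ : ∀ (j : ι) (w : List L) (x : FockSpace L),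
      x ∈ wordSpan {u | u ∈ wordsOver (J j) ∧ u ≠ []} →
      appendWord w x ∈ wordSpan {u | ∃ x ∈ J j, u.head? = some x} := by
    intro j w x hx
    induction hx using Submodule.span_induction with
    | mem y hy =>
      obtain ⟨u, ⟨hu, hne⟩, rfl⟩ := hy
      rw [appendWord_apply]
      refine Submodule.subset_span ⟨_, ?_, rfl⟩
      rcases u with _ | ⟨y, u⟩
      · exact absurd rfl hne
      · exact ⟨y, hu y (by simp), by simp⟩
    | zero => simp
    | add y z _ _ hy hz => rw [map_add]; exact Submodule.add_mem _ hy hz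
    | smul c y _ hy => rw [map_smul]; exact Submodule.smul_mem _ c hy
  induction n with
  | zero =>
    intro i a _ ha h0
    have := happ (i 0) [] _ (hvac _ _ (ha 0) (h0 0))
    have h : ∀ x, appendWord ([] : List L) x = x := fun x => by
      have : (appendWord ([] : List L)).toContinuousLinearMap = 1 := by
        refine ContinuousLinearMap.ext_on
          (Submodule.dense_iff_topologicalClosure_eq_top.2 (fockBasis L).dense_span) ?_
        rintro _ ⟨w, rfl⟩
        simp [appendWord_apply]
      exact DFunLike.congr_fun this x
    rw [h] at this
    simpa using this
  | succ n ih =>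
    intro i a hi ha h0
    have h := ih (fun k => i k.succ) (fun k => a k.succ) (fun k => hi k.succ)
      (fun k => ha _) (fun k => h0 _)
    rw [List.ofFn_succ, List.prod_cons, mul_apply_eq_comp]
    generalize (List.ofFn fun k => a k.succ).prod (fockBasis L []) = x at h
    induction h using Submodule.span_induction with
    | mem y hy =>
      obtain ⟨u, ⟨z, hz, hu⟩, rfl⟩ := hy
      have h1 : fockBasis L u = appendWord u (fockBasis L []) := by
        rw [appendWord_apply, List.nil_append]
      rw [h1, (ha 0 _ (Submodule.subset_span ⟨[], by simp [wordsOver], rfl⟩)).2 u]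
      · exact happ _ _ _ (hvac _ _ (ha 0) (h0 0))
      · intro y hy
        rw [hu, Option.mem_some_iff] at hy
        subst hy
        exact Set.disjoint_right.1 (hJ _ _ (hi 0)) hz
    | zero => simp
    | add y z _ _ hy hz => rw [map_add]; exact Submodule.add_mem _ hy hz
    | smul c y _ hy => rw [map_smul]; exact Submodule.smul_mem _ c hy

/-- Sets of operators in disjoint sets of letters are free in the vacuum state. -/
theorem freeSubsets_vacuumState {L ι : Type*} {J : ι → Set L}
    (hJ : ∀ i j, i ≠ j → Disjoint (J i) (J j)) (s : ι → Set (FockSpace L →L[ℂ] FockSpace L))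
    (hs : ∀ i, s i ⊆ letterSubalgebra (J i)) : FreeSubsets (vacuumState L) s := by
  classical
  intro n i a hi ha h0
  have h := prod_apply_vacuum_mem hJ n i a hi
    (fun k => (Algebra.adjoin_le (hs (i k))) (ha k)) h0
  rw [vacuumState_apply]
  generalize (List.ofFn a).prod (fockBasis L []) = x at h
  induction h using Submodule.span_induction with
  | mem y hy =>
    obtain ⟨u, ⟨z, hz, hu⟩, rfl⟩ := hy
    rw [fockBasis_inner, if_neg]
    rintro rfl
    simp at hu
  | zero => simp
  | add y z _ _ hy hz => rw [inner_add_right, hy, hz, add_zero]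
  | smul c y _ hy => rw [inner_smul_right, hy, mul_zero]

/-- Circular elements on the Fock space. -/
def fockCircular (m : ℕ) (i : Fin m) :
    FockSpace (Fin m × Bool) →L[ℂ] FockSpace (Fin m × Bool) :=
  ((Real.sqrt 2 : ℝ) : ℂ)⁻¹ • ((creation (i, false) + star (creation (i, false))) +
    Complex.I • (creation (i, true) + star (creation (i, true))))

theorem fockCircular_isFreeCircularFamily (m : ℕ) :
    IsFreeCircularFamily (vacuumState (Fin m × Bool)) (fockCircular m) where
  isCircular i := by
    refine ⟨_, _, isSemicircular_creation _, isSemicircular_creation _, ?_, rfl⟩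
    refine freeSubsets_vacuumState (J := ![{(i, false)}, {(i, true)}]) ?_ _ ?_
    · intro a b hab
      fin_cases a <;> fin_cases b <;> simp at hab ⊢
    · intro a
      have h : ∀ p : Fin m × Bool, creation p + star (creation p) ∈ letterSubalgebra {p} :=
        fun p => Subalgebra.add_mem _ (creation_mem_letterSubalgebra (Set.mem_singleton p))
          (star_creation_mem_letterSubalgebra (Set.mem_singleton p))
      fin_cases a
      · exact Set.singleton_subset_iff.2 (h _)
      · exact Set.singleton_subset_iff.2 (h _)
  free := by
    refine freeSubsets_vacuumState (J := fun i => {p | p.1 = i}) ?_ _ ?_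
    · intro i j hij
      rw [Set.disjoint_left]
      rintro p rfl h
      exact hij h
    · intro i
      have h : ∀ b, creation (i, b) ∈ letterSubalgebra {p : Fin m × Bool | p.1 = i} := fun b =>
        creation_mem_letterSubalgebra rfl
      have h' : ∀ b, star (creation (i, b)) ∈ letterSubalgebra {p : Fin m × Bool | p.1 = i} :=
        fun b => star_creation_mem_letterSubalgebra rfl
      have hadd : ∀ b, creation (i, b) + star (creation (i, b)) ∈
          letterSubalgebra {p : Fin m × Bool | p.1 = i} := fun b =>
        Subalgebra.add_mem _ (h b) (h' b)
      rintro x (rfl | rfl)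
      · exact Subalgebra.smul_mem _ (Subalgebra.add_mem _ (hadd _)
          (Subalgebra.smul_mem _ (hadd _) _)) _
      · have e : star (fockCircular m i) = (star ((Real.sqrt 2 : ℝ) : ℂ)⁻¹) •
            ((creation (i, false) + star (creation (i, false))) +
              star Complex.I • (creation (i, true) + star (creation (i, true)))) := by
          rw [fockCircular, star_smul, star_add, star_smul,
            (IsSelfAdjoint.add_star_self (creation (i, false))).star_eq,
            (IsSelfAdjoint.add_star_self (creation (i, true))).star_eq]
        rw [e]
        exact Subalgebra.smul_mem _ (Subalgebra.add_mem _ (hadd _)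
          (Subalgebra.smul_mem _ (hadd _) _)) _

/-- The index of the adjoint of a member of a family of matrices and their adjoints. -/
def adjointIndex {ι : Type*} (p : ι × Bool) : ι × Bool := (p.1, !p.2)

theorem adjointIndex_involutive {ι : Type*} :
    Function.Involutive (adjointIndex : ι × Bool → ι × Bool) := fun p => by simp [adjointIndex]

/-- The creation operators of the unit vectors `(e_{i,0} ± √-1 e_{i,1}) / √2`. -/
def rotatedCreation {ι : Type*} (p : ι × Bool) :
    FockSpace (ι × Bool) →L[ℂ] FockSpace (ι × Bool) :=
  ((Real.sqrt 2 : ℝ) : ℂ)⁻¹ • (creation (p.1, false) +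
    (cond p.2 (-Complex.I) Complex.I) • creation (p.1, true))

/-- Puts c and c* into the form l(p) + l(bar p)* required by `inner_prod_eq_stackCount`; the rotated
unit vectors are again orthonormal, whence the relations in `star_rotatedCreation_mul`. -/
theorem withAdjoints_fockCircular (m : ℕ) (p : Fin m × Bool) :
    withAdjoints (fockCircular m) p = rotatedCreation p + star (rotatedCreation (adjointIndex p)) := by
  obtain ⟨i, b⟩ := p
  cases b
  · simp only [withAdjoints, fockCircular, rotatedCreation, adjointIndex, star_smul, star_add,
      cond_true, cond_false, Bool.not_false]
    simp only [Complex.star_def, map_inv₀, map_neg, Complex.conj_ofReal, Complex.conj_I]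
    module
  · simp only [withAdjoints, fockCircular, rotatedCreation, adjointIndex, star_smul, star_add,
      cond_true, cond_false, Bool.not_true, star_star]
    simp only [Complex.star_def, map_inv₀, Complex.conj_ofReal, Complex.conj_I]
    module

theorem star_rotatedCreation_mul {ι : Type*} [DecidableEq ι] (p q : ι × Bool) :
    star (rotatedCreation p) * rotatedCreation q = if p = q then 1 else 0 := by
  obtain ⟨i, b⟩ := p
  obtain ⟨j, c⟩ := q
  have h2 : ((Real.sqrt 2 : ℝ) : ℂ)⁻¹ * ((Real.sqrt 2 : ℝ) : ℂ)⁻¹ = 1 / 2 := by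
    rw [← mul_inv, ← Complex.ofReal_mul, Real.mul_self_sqrt (by norm_num)]
    norm_num
  have hI : ∀ b c : Bool, star (cond b (-Complex.I) Complex.I) * cond c (-Complex.I) Complex.I =
      if b = c then 1 else -1 := by
    intro b c
    cases b <;> cases c <;> simp
  have e : star (rotatedCreation (i, b)) * rotatedCreation (j, c) =
      (star ((Real.sqrt 2 : ℝ) : ℂ)⁻¹ * ((Real.sqrt 2 : ℝ) : ℂ)⁻¹) •
        (star (creation (i, false)) * creation (j, false) +
          (cond c (-Complex.I) Complex.I) • (star (creation (i, false)) * creation (j, true)) +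
          star (cond b (-Complex.I) Complex.I) •
            (star (creation (i, true)) * creation (j, false)) +
          (star (cond b (-Complex.I) Complex.I) * cond c (-Complex.I) Complex.I) •
            (star (creation (i, true)) * creation (j, true))) := by
    simp only [rotatedCreation, star_smul, star_add, add_mul, mul_add, smul_mul_assoc,
      mul_smul_comm, smul_add, smul_smul, star_mul']
    module
  rw [e, hI, star_creation_mul_creation, star_creation_mul_creation, star_creation_mul_creation,
    star_creation_mul_creation, Complex.star_def, map_inv₀, Complex.conj_ofReal, h2]
  by_cases hij : i = j
  · subst hij
    by_cases hbc : b = c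
    · simp only [hbc, Prod.mk.injEq, if_true, reduceCtorEq, and_false, if_false]
      module
    · simp only [hbc, Prod.mk.injEq, if_true, reduceCtorEq, and_false, if_false]
      module
  · simp [hij]

theorem star_rotatedCreation_apply_nil {ι : Type*} (p : ι × Bool) :
    star (rotatedCreation p) (fockBasis (ι × Bool) []) = 0 := by
  simp [rotatedCreation, star_smul, star_add, star_creation_apply_nil]

theorem vacuumState_prod_fockCircular (m : ℕ) (w : List (Fin m × Bool)) :
    vacuumState (Fin m × Bool) (w.map (withAdjoints (fockCircular m))).prod =
      (stackCount adjointIndex w [] : ℂ) := by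
  rw [← inner_prod_eq_stackCount adjointIndex_involutive rotatedCreation star_rotatedCreation_mul
    (Ω := fockBasis _ []) (by rw [fockBasis_inner, if_pos rfl]) star_rotatedCreation_apply_nil w [],
    vacuumState_apply, funext (withAdjoints_fockCircular m)]
  simp

/-- The moments of free circular elements and their adjoints count noncrossing pairings. -/
theorem IsFreeCircularFamily.moments_eq_stackCount {A : Type*} [CStarAlgebra A] {φ : A →ₗ[ℂ] ℂ}
    (hφ : φ 1 = 1) {m : ℕ} {c : Fin m → A} (h : IsFreeCircularFamily φ c)
    (w : List (Fin m × Bool)) :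
    φ (w.map (withAdjoints c)).prod = (stackCount adjointIndex w [] : ℂ) := by
  rw [← vacuumState_prod_fockCircular]
  exact h.moments_unique hφ (vacuumState_isState _).map_one (fockCircular_isFreeCircularFamily m) w

end Fock

/-! ### Word equations in a finite group: crossing pairings are negligible. -/

section WordCount

/-- A nonempty fibre of y ↦ y z y⁻¹ is a coset of the centralizer of z. -/
theorem card_filter_conj_le {G : Type*} [Group G] [Fintype G] [DecidableEq G] (z h : G) :
    (Finset.univ.filter fun y : G => y * z * y⁻¹ = h).card ≤
      (Finset.univ.filter fun y : G => z * y = y * z).card := by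
  rcases (Finset.univ.filter fun y : G => y * z * y⁻¹ = h).eq_empty_or_nonempty with he | ⟨y₀, hy₀⟩
  · simp [he]
  · refine Finset.card_le_card_of_injOn (fun y => y₀⁻¹ * y) ?_ ((mul_right_injective _).injOn)
    intro y hy
    simp only [Finset.coe_filter, Finset.mem_univ, true_and, Set.mem_ofPred_eq,
      Finset.mem_filter] at hy hy₀ ⊢
    rw [← hy₀] at hy
    have h1 : y₀⁻¹ * y * z = z * (y₀⁻¹ * y) := by
      have h2 : y * z = y₀ * z * y₀⁻¹ * y := by rw [← hy]; group
      rw [mul_assoc, h2]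
      group
    exact h1.symm

/-- The proportion of solutions of an equation in which `y, x, y⁻¹, x⁻¹` occur in this order is at
most the commuting probability. -/
theorem expect_crossing_le {G : Type*} [Group G] [Fintype G] [DecidableEq G] (a b c d : G) :
    (Finset.univ.expect fun x : G => Finset.univ.expect fun y : G =>
      if a * y * b * x * y⁻¹ * c * x⁻¹ * d = 1 then (1 : ℝ) else 0) ≤ commProb G := by
  have h1 : ∀ x : G, (Finset.univ.expect fun y : G =>
      if a * y * b * x * y⁻¹ * c * x⁻¹ * d = 1 then (1 : ℝ) else 0) ≤
      Finset.univ.expect fun y : G => if b * x * y = y * (b * x) then (1 : ℝ) else 0 := by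
    intro x
    rw [Fintype.expect_eq_sum_div_card, Fintype.expect_eq_sum_div_card]
    refine div_le_div_of_nonneg_right ?_ (Nat.cast_nonneg _)
    rw [Finset.sum_boole, Finset.sum_boole]
    -- For fixed x the equation says y (b x) y⁻¹ = a⁻¹ d⁻¹ x c⁻¹, a fibre of conjugation of b x;
    -- afterwards b x is replaced by a uniform element.
    refine Nat.cast_le.2 (le_trans (Finset.card_le_card ?_)
      (card_filter_conj_le (b * x) (a⁻¹ * d⁻¹ * x * c⁻¹)))
    intro y hy
    simp only [Finset.mem_filter, Finset.mem_univ, true_and] at hy ⊢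
    have h2 : a * (y * (b * x) * y⁻¹) * (c * x⁻¹ * d) = 1 := by rw [← hy]; group
    rw [mul_eq_one_iff_eq_inv] at h2
    rw [← mul_right_inj a, h2]
    group
  refine (Finset.expect_le_expect fun x _ => h1 x).trans (le_of_eq ?_)
  rw [Fintype.expect_equiv (Equiv.mulLeft b) (fun x => Finset.univ.expect fun y : G =>
    if b * x * y = y * (b * x) then (1 : ℝ) else 0) (fun x => Finset.univ.expect fun y : G =>
    if x * y = y * x then (1 : ℝ) else 0) (fun x => rfl)]
  simp only [Fintype.expect_eq_sum_div_card]
  rw [← Finset.sum_div, commProb_def, div_div, ← sq]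
  push_cast
  have h2 : Nat.card { p : G × G // Commute p.1 p.2 } =
      (Finset.univ.filter fun p : G × G => p.1 * p.2 = p.2 * p.1).card := by
    rw [← Fintype.card_subtype, ← Nat.card_eq_fintype_card]
    rfl
  rw [h2, Nat.card_eq_fintype_card]
  congr 1
  rw [← Finset.univ_product_univ, Finset.card_filter, Finset.sum_product, Nat.cast_sum]
  simp

theorem expect_comm₃ {X Y Z : Type*} [Fintype X] [Fintype Y] [Fintype Z] (f : X → Y → Z → ℝ) :
    (Finset.univ.expect fun x => Finset.univ.expect fun y => Finset.univ.expect fun z => f x y z) =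
      Finset.univ.expect fun z => Finset.univ.expect fun x => Finset.univ.expect fun y =>
        f x y z :=
  (Finset.expect_congr rfl fun _ _ => Finset.expect_comm _ _ _).trans (Finset.expect_comm _ _ _)

/-- The sum over all ways to remove an element from a multiset. -/
def removalSum {S M : Type*} [DecidableEq S] [AddCommMonoid M] (F : S → Multiset S → M)
    (u : Multiset S) : M := (u.map fun s => F s (u.erase s)).sum

theorem removalSum_zero {S M : Type*} [DecidableEq S] [AddCommMonoid M]
    (F : S → Multiset S → M) : removalSum F 0 = 0 := rfl

theorem removalSum_cons {S M : Type*} [DecidableEq S] [AddCommMonoid M] (F : S → Multiset S → M)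
    (s : S) (u : Multiset S) :
    removalSum F (s ::ₘ u) = F s u + removalSum (fun t v => F t (s ::ₘ v)) u := by
  rw [removalSum, Multiset.map_cons, Multiset.sum_cons, Multiset.erase_cons_head]
  congr 2
  refine Multiset.map_congr rfl fun t ht => ?_
  rw [Multiset.erase_cons_tail_of_mem ht]

theorem removalSum_expect {S ι : Type*} [DecidableEq S] [Fintype ι] (F : ι → S → Multiset S → ℝ)
    (u : Multiset S) :
    (Finset.univ.expect fun i => removalSum (F i) u) =
      removalSum (fun s v => Finset.univ.expect fun i => F i s v) u := by
  induction u using Multiset.induction_on generalizing F with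
  | empty => simp [removalSum_zero]
  | cons s u ih => simp only [removalSum_cons, Finset.expect_add_distrib, ih]

theorem removalSum_nonneg {S : Type*} [DecidableEq S] {F : S → Multiset S → ℝ}
    (h : ∀ s v, 0 ≤ F s v) (u : Multiset S) : 0 ≤ removalSum F u := by
  refine Multiset.sum_nonneg fun x hx => ?_
  obtain ⟨s, _, rfl⟩ := Multiset.mem_map.1 hx
  exact h _ _

theorem removalSum_le {S : Type*} [DecidableEq S] {F : S → Multiset S → ℝ} {u : Multiset S} {C : ℝ}
    (h : ∀ s v, v.card + 1 = u.card → F s v ≤ C) : removalSum F u ≤ u.card * C := by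
  have := Multiset.sum_le_card_nsmul (u.map fun s => F s (u.erase s)) C ?_
  · simpa [removalSum] using this
  · intro x hx
    obtain ⟨s, hs, rfl⟩ := Multiset.mem_map.1 hx
    exact h _ _ (Multiset.card_erase_add_one hs)

/-- The proportion of solutions of word equations, summed over pairings: the word `w` is read letter
by letter; each letter `p` either gets a new uniformly random value `x`, or the value inverse to that
of one of the open letters `bar p` in `u`, which is then removed from `u`. In the end no open letters
are left and the product of `g` with all values is `1`. -/
def pairingMean {P G : Type*} [DecidableEq P] [Group G] [DecidableEq G] [Fintype G] (bar : P → P) : List P → Multiset (P × G) → G → ℝ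
  | [], u, g => if u = 0 ∧ g = 1 then 1 else 0
  | p :: w, u, g =>
    (Finset.univ.expect fun x => pairingMean bar w ((p, x) ::ₘ u) (g * x)) +
      removalSum (fun s v => if s.1 = bar p then pairingMean bar w v (g * s.2⁻¹) else 0) u

/-- The number of ways to read a word of length `k` with `n` open letters, if every letter either
opens or closes any of the open ones. -/
def pathCount : ℕ → ℕ → ℕ
  | 0, _ => 1
  | k + 1, n => pathCount k (n + 1) + n * pathCount k (n - 1)

theorem pairingMean_nonneg {P G : Type*} [DecidableEq P] [Group G] [DecidableEq G] [Fintype G]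
    (bar : P → P) (w : List P) : ∀ (u : Multiset (P × G)) (g : G),
    0 ≤ pairingMean bar w u g := by
  induction w with
  | nil => intro u g; rw [pairingMean]; split_ifs <;> norm_num
  | cons p w ih =>
    intro u g
    rw [pairingMean]
    refine add_nonneg (Finset.expect_nonneg fun x _ => ih _ _) (removalSum_nonneg ?_ _)
    intro s v
    split_ifs
    · exact ih _ _
    · exact le_rfl

theorem commProb_cast_nonneg (G : Type*) [Group G] [Finite G] : (0 : ℝ) ≤ commProb G := by
  exact_mod_cast (commProb_pos G).le

/-- The crossing of x and y is already complete. Later letters only multiply on the right and are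
absorbed into d, so `expect_crossing_le` bounds each completion, and `pathCount` bounds their
number. -/
theorem expect_pairingMean_crossed_le {P G : Type*} [DecidableEq P] [Group G] [DecidableEq G] [Fintype G]
    (bar : P → P) (w : List P) : ∀ (v : Multiset (P × G)) (a b c d : G),
    (Finset.univ.expect fun x : G => Finset.univ.expect fun y : G =>
      pairingMean bar w v (a * y * b * x * y⁻¹ * c * x⁻¹ * d)) ≤
      pathCount w.length v.card * commProb G := by
  induction w with
  | nil =>
    intro v a b c d
    by_cases hv : v = 0
    · simpa [pairingMean, pathCount, hv] using expect_crossing_le a b c d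
    · simpa [pairingMean, pathCount, hv] using commProb_cast_nonneg G
  | cons p w ih =>
    intro v a b c d
    simp only [pairingMean, Finset.expect_add_distrib, removalSum_expect]
    rw [List.length_cons, pathCount, Nat.cast_add, Nat.cast_mul, add_mul, mul_assoc]
    refine add_le_add ?_ (removalSum_le fun s v' hv' => ?_)
    · rw [expect_comm₃]
      refine Finset.expect_le Finset.univ_nonempty fun z _ => ?_
      simpa [mul_assoc] using ih ((p, z) ::ₘ v) a b c (d * z)
    · split_ifs
      · simpa [mul_assoc, ← hv'] using ih v' a b c (d * s.2⁻¹)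
      · simpa using mul_nonneg (Nat.cast_nonneg _) (commProb_cast_nonneg G)

/-- Here y was closed while the later letter x is still open. The crossing is completed when x is
closed, which hands over to `expect_pairingMean_crossed_le`; if x is never closed, the reading
counts 0. -/
theorem expect_pairingMean_open_le {P G : Type*} [DecidableEq P] [Group G] [DecidableEq G] [Fintype G]
    (bar : P → P) (w : List P) (q : P) : ∀ (v : Multiset (P × G)) (a b c : G),
    (Finset.univ.expect fun x : G => Finset.univ.expect fun y : G =>
      pairingMean bar w ((q, x) ::ₘ v) (a * y * b * x * y⁻¹ * c)) ≤
      pathCount w.length (v.card + 1) * commProb G := by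
  induction w with
  | nil =>
    intro v a b c
    simpa [pairingMean, pathCount] using commProb_cast_nonneg G
  | cons p w ih =>
    intro v a b c
    simp only [pairingMean, Finset.expect_add_distrib, removalSum_cons, removalSum_expect]
    rw [List.length_cons, pathCount, Nat.cast_add, Nat.cast_mul, add_mul, mul_assoc,
      Nat.add_sub_cancel, Nat.cast_add, Nat.cast_one, add_mul (v.card : ℝ), one_mul,
      add_comm ((v.card : ℝ) * _)]
    refine add_le_add ?_ (add_le_add ?_ (removalSum_le fun s v' hv' => ?_))
    · rw [expect_comm₃]
      refine Finset.expect_le Finset.univ_nonempty fun z _ => ?_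
      simpa [mul_assoc, Multiset.cons_swap] using ih ((p, z) ::ₘ v) a b (c * z)
    · split_ifs
      · simpa using expect_pairingMean_crossed_le bar w v a b c 1
      · simpa using mul_nonneg (Nat.cast_nonneg _) (commProb_cast_nonneg G)
    · split_ifs
      · simpa [mul_assoc, hv'] using ih v' a b (c * s.2⁻¹)
      · simpa using mul_nonneg (Nat.cast_nonneg _) (commProb_cast_nonneg G)

/-- The mean over all assignments of group elements to the letters of a word. -/
def assignmentMean {P G : Type*} [Fintype G] : List P → (List (P × G) → ℝ) → ℝ
  | [], f => f []
  | p :: u, f => Finset.univ.expect fun x => assignmentMean u fun l => f ((p, x) :: l)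

/-- The product of the group elements in a list, in reverse order. -/
def reverseProd {P G : Type*} [Group G] (l : List (P × G)) : G := (l.map Prod.snd).reverse.prod

theorem reverseProd_cons {P G : Type*} [Group G] (s : P × G) (l : List (P × G)) :
    reverseProd (s :: l) = reverseProd l * s.2 := by simp [reverseProd]

theorem assignmentMean_add {P G : Type*} [Fintype G] (u : List P) : ∀ f g : List (P × G) → ℝ,
    assignmentMean u (fun l => f l + g l) = assignmentMean u f + assignmentMean u g := by
  induction u with
  | nil => intro f g; rfl
  | cons p u ih => intro f g; simp only [assignmentMean, ih, Finset.expect_add_distrib]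

theorem assignmentMean_expect {P G : Type*} [Fintype G] {X : Type*} [Fintype X] (u : List P) :
    ∀ f : X → List (P × G) → ℝ, assignmentMean u (fun l => Finset.univ.expect fun x => f x l) =
      Finset.univ.expect fun x => assignmentMean u (f x) := by
  induction u with
  | nil => intro f; rfl
  | cons p u ih => intro f; simp only [assignmentMean, ih]; rw [Finset.expect_comm]

theorem assignmentMean_le {P G : Type*} [Fintype G] [Nonempty G] (u : List P) : ∀ (f : List (P × G) → ℝ) (C : ℝ),
    (∀ l : List (P × G), l.length = u.length → f l ≤ C) → assignmentMean u f ≤ C := by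
  induction u with
  | nil => intro f C h; exact h [] rfl
  | cons p u ih =>
    intro f C h
    exact Finset.expect_le Finset.univ_nonempty fun x _ => ih _ _ fun l hl => h _ (by simpa using hl)

theorem assignmentMean_nonneg {P G : Type*} [Fintype G] (u : List P) : ∀ f : List (P × G) → ℝ,
    (∀ l : List (P × G), 0 ≤ f l) → 0 ≤ assignmentMean u f := by
  induction u with
  | nil => intro f h; exact h []
  | cons p u ih => intro f h; exact Finset.expect_nonneg fun x _ => ih _ fun l => h _

/-- Bounds the readings in which a letter s below the top letter (q, x) of the stack is closed, so
that s and x must cross. In the induction `v` and `b` collect the stack letters between s and x and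
their product. -/
theorem assignmentMean_removal_le {P G : Type*} [DecidableEq P] [Group G] [DecidableEq G] [Fintype G]
    (bar : P → P) (w : List P) (q t : P) (u : List P) :
    ∀ (v : Multiset (P × G)) (b : G),
    (Finset.univ.expect fun x : G => assignmentMean u fun l =>
      removalSum (fun s v' => if s.1 = t then
        pairingMean bar w ((q, x) ::ₘ (v + v')) (reverseProd l * b * x * s.2⁻¹) else 0)
        (l : Multiset (P × G))) ≤
      u.length * (pathCount w.length (v.card + u.length) * commProb G) := by
  induction u with
  | nil => intro v b; simp [assignmentMean, removalSum_zero]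
  | cons r u ih =>
    intro v b
    simp only [assignmentMean, ← Multiset.cons_coe, removalSum_cons, assignmentMean_add,
      Finset.expect_add_distrib, reverseProd_cons]
    rw [List.length_cons, Nat.cast_add, Nat.cast_one, add_mul (u.length : ℝ), one_mul,
      add_comm ((u.length : ℝ) * _)]
    refine add_le_add ?_ ?_
    · simp only [← assignmentMean_expect]
      refine assignmentMean_le _ _ _ fun l hl => ?_
      split_ifs
      · have := expect_pairingMean_open_le bar w q (v + (l : Multiset (P × G))) (reverseProd l) b 1
        simpa [hl, add_assoc] using this
      · simpa using mul_nonneg (Nat.cast_nonneg _) (commProb_cast_nonneg G)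
    · rw [Finset.expect_comm]
      refine Finset.expect_le Finset.univ_nonempty fun y _ => ?_
      have := ih ((r, y) ::ₘ v) (y * b)
      simpa [mul_assoc, add_assoc, add_comm 1 u.length] using this

/-- The number of crossing readings of a word. -/
def crossingCount : ℕ → ℕ → ℕ
  | 0, _ => 0
  | k + 1, n => crossingCount k (n + 1) + (crossingCount k (n - 1) + (n - 1) * pathCount k (n - 1))

/-- As long as no crossing has occurred, the group element read so far is the product of the open
letters in stack order. Averaging over their values reproduces the recursion of `stackCount`: a new
letter is pushed, and closing the top letter cancels its value. Closing a lower letter is the first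
crossing, and its contribution is an error of order `commProb G`. -/
theorem abs_assignmentMean_sub_stackCount_le {P G : Type*} [DecidableEq P] [Group G] [DecidableEq G] [Fintype G]
    (bar : P → P) (w : List P) : ∀ u : List P,
    |assignmentMean u (fun l : List (P × G) => pairingMean bar w l (reverseProd l)) -
      stackCount bar w u| ≤ crossingCount w.length u.length * commProb G := by
  induction w with
  | nil =>
    intro u
    rcases u with _ | ⟨q, u⟩
    · simp [assignmentMean, pairingMean, stackCount, crossingCount, reverseProd]
    · have : assignmentMean (q :: u) (fun l : List (P × G) =>
          pairingMean bar [] (l : Multiset (P × G)) (reverseProd l)) = 0 := by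
        refine le_antisymm ?_ (assignmentMean_nonneg _ _ fun l => pairingMean_nonneg _ _ _ _)
        refine assignmentMean_le _ _ _ fun l hl => ?_
        have : (l : Multiset (P × G)) ≠ 0 := by
          rintro h
          rw [Multiset.coe_eq_zero] at h
          simp [h] at hl
        simp [pairingMean, this]
      simp [this, stackCount, crossingCount]
  | cons p w ih =>
    intro u
    have h1 := ih (p :: u)
    simp only [assignmentMean, reverseProd_cons, ← Multiset.cons_coe] at h1
    simp only [pairingMean, assignmentMean_add, assignmentMean_expect]
    have hκ := commProb_cast_nonneg G
    rcases u with _ | ⟨q, u⟩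
    -- For the empty stack the truncated n - 1 leaves a spurious nonnegative term in
    -- `crossingCount`, which only weakens the bound.
    · have h2 : (0 : ℝ) ≤ crossingCount w.length 0 * commProb G := by positivity
      simp only [assignmentMean, Multiset.coe_nil, removalSum_zero, add_zero, stackCount,
        List.head?_nil, reduceCtorEq, if_false, List.length_cons, List.length_nil, crossingCount,
        Nat.cast_add, Nat.cast_mul, add_mul] at h1 ⊢
      simp only [CharP.cast_eq_zero, zero_mul, add_zero] at h1 ⊢
      exact h1.trans (le_add_of_nonneg_right h2)
    · have h2 := ih u
      have h3 := assignmentMean_removal_le (G := G) bar w q (bar p) u 0 1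
      have h4 : (0 : ℝ) ≤ Finset.univ.expect fun x : G => assignmentMean u fun l =>
          removalSum (fun s v' => if s.1 = bar p then
            pairingMean bar w ((q, x) ::ₘ (0 + v')) (reverseProd l * 1 * x * s.2⁻¹) else 0)
            (l : Multiset (P × G)) := by
        refine Finset.expect_nonneg fun x _ => assignmentMean_nonneg _ _ fun l => ?_
        refine removalSum_nonneg (fun s v => ?_) _
        split_ifs
        · exact pairingMean_nonneg _ _ _ _
        · exact le_rfl
      -- Separates closing the top letter, where x cancels and the mean over x is trivial, from
      -- closing a lower one.
      have h5 : assignmentMean (q :: u) (fun l : List (P × G) => removalSum (fun s v =>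
            if s.1 = bar p then pairingMean bar w v (reverseProd l * s.2⁻¹) else 0)
              (l : Multiset (P × G))) =
          (if q = bar p then assignmentMean u (fun l : List (P × G) =>
            pairingMean bar w l (reverseProd l)) else 0) +
          Finset.univ.expect fun x : G => assignmentMean u fun l =>
          removalSum (fun s v' => if s.1 = bar p then
            pairingMean bar w ((q, x) ::ₘ (0 + v')) (reverseProd l * 1 * x * s.2⁻¹) else 0)
            (l : Multiset (P × G)) := by
        simp only [assignmentMean, ← Multiset.cons_coe, removalSum_cons, assignmentMean_add,
          Finset.expect_add_distrib, reverseProd_cons, mul_inv_cancel_right, mul_one, zero_add]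
        congr 1
        rw [Fintype.expect_const]
        split_ifs
        · rfl
        · refine le_antisymm (assignmentMean_le _ _ _ fun l _ => le_rfl)
            (assignmentMean_nonneg _ _ fun l => le_rfl)
      rw [h5]
      generalize (Finset.univ.expect fun x : G => assignmentMean u fun l =>
          removalSum (fun s v' => if s.1 = bar p then
            pairingMean bar w ((q, x) ::ₘ (0 + v')) (reverseProd l * 1 * x * s.2⁻¹) else 0)
            (l : Multiset (P × G))) = R at h3 h4
      rw [stackCount, List.head?_cons, List.tail_cons]
      have hc : (0 : ℝ) ≤ crossingCount w.length u.length * commProb G := by positivity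
      have h6 : |(if q = bar p then assignmentMean u (fun l : List (P × G) =>
            pairingMean bar w l (reverseProd l)) else 0) -
          ((if some q = some (bar p) then stackCount bar w u else 0 : ℕ) : ℝ)| ≤
          crossingCount w.length u.length * commProb G := by
        by_cases hq : q = bar p
        · simpa [hq] using h2
        · simpa [hq] using hc
      have h7 : ((crossingCount (p :: w).length (q :: u).length : ℕ) : ℝ) * commProb G =
          crossingCount w.length (p :: q :: u).length * commProb G +
          crossingCount w.length u.length * commProb G +
          u.length * (pathCount w.length (0 + u.length) * commProb G) := by
        simp only [List.length_cons, crossingCount, Nat.add_sub_cancel, zero_add]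
        push_cast
        ring
      rw [h7, Nat.cast_add]
      rw [Multiset.card_zero] at h3
      rw [abs_le] at h1 h6 ⊢
      simp only [assignmentMean, reverseProd_cons, ← Multiset.cons_coe] at h1 ⊢
      constructor
      · linarith [h1.1, h6.1]
      · linarith [h1.2, h6.2]

end WordCount

/-! ### Sums over group elements, matchings and sparse keys. -/

section Matchings

/-- The sum over all assignments of group elements to the letters of a word. -/
def wordSum {P G M : Type*} [Fintype G] [AddCommMonoid M] : List P → (List (P × G) → M) → M
  | [], f => f []
  | p :: w, f => ∑ x, wordSum w fun l => f ((p, x) :: l)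

theorem wordSum_add {P G M : Type*} [Fintype G] [AddCommMonoid M] (w : List P) :
    ∀ f g : List (P × G) → M, wordSum w (fun l => f l + g l) = wordSum w f + wordSum w g := by
  induction w with
  | nil => intro f g; rfl
  | cons p w ih => intro f g; simp only [wordSum, ih, Finset.sum_add_distrib]

theorem map_wordSum {P G M M' F : Type*} [Fintype G] [AddCommMonoid M] [AddCommMonoid M']
    [FunLike F M M'] [AddMonoidHomClass F M M'] (φ : F) (w : List P) :
    ∀ f : List (P × G) → M, φ (wordSum w f) = wordSum w fun l => φ (f l) := by
  induction w with
  | nil => intro f; rfl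
  | cons p w ih => intro f; simp only [wordSum, map_sum, ih]

theorem wordSum_zero {P G M : Type*} [Fintype G] [AddCommMonoid M] (w : List P) :
    wordSum w (fun _ : List (P × G) => (0 : M)) = 0 := by
  induction w with
  | nil => rfl
  | cons p w ih => simp [wordSum, ih]

theorem mul_wordSum {P G R : Type*} [Fintype G] [Semiring R] (w : List P) (c : R)
    (f : List (P × G) → R) : c * wordSum w f = wordSum w fun l => c * f l :=
  map_wordSum (AddMonoidHom.mulLeft c) w f

theorem wordSum_removalSum {P G S : Type*} [Fintype G] [DecidableEq S] (w : List P)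
    (u : Multiset S) : ∀ F : List (P × G) → S → Multiset S → ℝ,
    wordSum w (fun l => removalSum (F l) u) = removalSum (fun s v => wordSum w fun l => F l s v) u := by
  induction u using Multiset.induction_on with
  | empty => intro F; simp [removalSum_zero, wordSum_zero]
  | cons s u ih => intro F; simp only [removalSum_cons, wordSum_add, ih]

theorem sum_removalSum {X S : Type*} [Fintype X] [DecidableEq S] (u : Multiset S) :
    ∀ F : X → S → Multiset S → ℝ,
    ∑ x, removalSum (F x) u = removalSum (fun s v => ∑ x, F x s v) u := by
  induction u using Multiset.induction_on with
  | empty => intro F; simp [removalSum_zero]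
  | cons s u ih => intro F; simp only [removalSum_cons, Finset.sum_add_distrib, ih]

theorem wordSum_le {P G : Type*} [Fintype G] (w : List P) : ∀ f g : List (P × G) → ℝ,
    (∀ l : List (P × G), l.length = w.length → f l ≤ g l) → wordSum w f ≤ wordSum w g := by
  induction w with
  | nil => intro f g h; exact h [] rfl
  | cons p w ih =>
    intro f g h
    exact Finset.sum_le_sum fun x _ => ih _ _ fun l hl => h _ (by simpa using hl)

theorem norm_wordSum_le {P G : Type*} [Fintype G] (w : List P) : ∀ f : List (P × G) → ℂ,
    ‖wordSum w f‖ ≤ wordSum w fun l => ‖f l‖ := by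
  induction w with
  | nil => intro f; exact le_rfl
  | cons p w ih =>
    intro f
    exact (norm_sum_le _ _).trans (Finset.sum_le_sum fun x _ => ih _)

/-- The number of perfect matchings, pairing `s` with `bar s`, of the elements of a list and of the
elements of a multiset, where the elements of the multiset are not matched among themselves. -/
def matchCount {S : Type*} [DecidableEq S] (bar : S → S) : List S → Multiset S → ℕ
  | [], u => if u = 0 then 1 else 0
  | s :: l, u => matchCount bar l (s ::ₘ u) +
      removalSum (fun t v => if t = bar s then matchCount bar l v else 0) u

theorem removalSum_ite {S : Type*} [DecidableEq S] (a : S) (F : Multiset S → ℕ)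
    (u : Multiset S) :
    removalSum (fun t v => if t = a then F v else 0) u = u.count a * F (u.erase a) := by
  have h : ∀ (c : ℕ) (v : Multiset S),
      (v.map fun s => if s = a then c else 0).sum = v.count a * c := by
    intro c v
    induction v using Multiset.induction_on with
    | empty => simp
    | cons s v ih =>
      rw [Multiset.map_cons, Multiset.sum_cons, ih, Multiset.count_cons]
      by_cases hs : s = a
      · simp [hs]; ring
      · simp [hs, Ne.symm hs]
  rw [← h, removalSum]
  congr 1
  refine Multiset.map_congr rfl fun s _ => ?_
  split_ifs with hs
  · rw [hs]
  · rfl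

theorem matchCount_map {S T : Type*} [DecidableEq S] [DecidableEq T] {barS : S → S}
    {barT : T → T} {e : S → T} (he : Function.Injective e) (hbar : ∀ s, e (barS s) = barT (e s))
    (l : List S) : ∀ u : Multiset S,
    matchCount barT (l.map e) (u.map e) = matchCount barS l u := by
  induction l with
  | nil => intro u; simp [matchCount]
  | cons s l ih =>
    intro u
    rw [List.map_cons, matchCount, matchCount, removalSum_ite, removalSum_ite, ← hbar,
      ← Multiset.map_cons, ih, Multiset.count_map_eq_count' _ _ he, ← Multiset.map_erase _ he, ih]

/-- The inverse of a group element labelled by a letter. -/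
def labelledInv {P G : Type*} [Inv G] (bar : P → P) (s : P × G) : P × G := (bar s.1, s.2⁻¹)

/-- Exchanges the sums over values and over matchings. A pair inside the word has one free value,
worth |G|, that is √|G| per letter; a letter closing an element of `u` has a prescribed value, which
the power of √|G| on the left compensates. -/
theorem wordSum_matchCount {P G : Type*} [DecidableEq P] [Group G] [DecidableEq G] [Fintype G]
    (bar : P → P) (w : List P) : ∀ (u : Multiset (P × G)) (g : G),
    √(Fintype.card G) ^ u.card * wordSum w (fun l => if g * (l.map Prod.snd).prod = 1 then
      (matchCount (labelledInv bar) l u : ℝ) else 0) =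
    √(Fintype.card G) ^ w.length * pairingMean bar w u g := by
  have hcard : (0 : ℝ) < Fintype.card G := Nat.cast_pos.2 Fintype.card_pos
  have hq : √(Fintype.card G) ^ 2 = Fintype.card G := Real.sq_sqrt hcard.le
  have hq0 : √(Fintype.card G : ℝ) ≠ 0 := (Real.sqrt_pos.2 hcard).ne'
  set q := √(Fintype.card G : ℝ) with hqdef
  induction w with
  | nil =>
    intro u g
    by_cases hu : u = 0
    · by_cases hg : g = 1 <;> simp [wordSum, pairingMean, matchCount, hu, hg]
    · simp [wordSum, pairingMean, matchCount, hu]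
  | cons p w ih =>
    intro u g
    have e : ∀ (x : G), wordSum w (fun l => if g * (((p, x) :: l).map Prod.snd).prod = 1 then
        (matchCount (labelledInv bar) ((p, x) :: l) u : ℝ) else 0) =
        wordSum w (fun l => if g * x * (l.map Prod.snd).prod = 1 then
          (matchCount (labelledInv bar) l ((p, x) ::ₘ u) : ℝ) else 0) +
        removalSum (fun t v => if t = (bar p, x⁻¹) then
          wordSum w (fun l => if g * x * (l.map Prod.snd).prod = 1 then
          (matchCount (labelledInv bar) l v : ℝ) else 0) else 0) u := by
      intro x
      have h : ∀ l : List (P × G), (if g * (((p, x) :: l).map Prod.snd).prod = 1 then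
          (matchCount (labelledInv bar) ((p, x) :: l) u : ℝ) else 0) =
          (if g * x * (l.map Prod.snd).prod = 1 then
            (matchCount (labelledInv bar) l ((p, x) ::ₘ u) : ℝ) else 0) +
          removalSum (fun t v => if t = (bar p, x⁻¹) then
            (if g * x * (l.map Prod.snd).prod = 1 then
            (matchCount (labelledInv bar) l v : ℝ) else 0) else 0) u := by
        intro l
        rw [List.map_cons, List.prod_cons, ← mul_assoc]
        by_cases hg : g * x * (l.map Prod.snd).prod = 1
        · simp only [hg, if_true, matchCount, Nat.cast_add]
          congr 1
          simp only [removalSum]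
          rw [← Nat.coe_castAddMonoidHom, map_multiset_sum, Multiset.map_map]
          congr 1
          refine Multiset.map_congr rfl fun t _ => ?_
          by_cases ht : t = (bar p, x⁻¹) <;> simp [labelledInv, ht]
        · simp [hg, removalSum]
      simp only [h, wordSum_add, wordSum_removalSum]
      congr 2
      ext t v
      split_ifs
      · rfl
      · exact wordSum_zero w
    simp only [wordSum, e]
    rw [Finset.sum_add_distrib, sum_removalSum, pairingMean, mul_add, mul_add]
    congr 1
    · have h := fun x => ih ((p, x) ::ₘ u) (g * x)
      rw [Fintype.expect_eq_sum_div_card, List.length_cons, ← hq]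
      have h2 : q ^ u.card * ∑ x : G, wordSum w (fun l => if g * x * (l.map Prod.snd).prod = 1 then
          (matchCount (labelledInv bar) l ((p, x) ::ₘ u) : ℝ) else 0) =
          q⁻¹ * ∑ x : G, q ^ w.length * pairingMean bar w ((p, x) ::ₘ u) (g * x) := by
        rw [Finset.mul_sum, Finset.mul_sum]
        refine Finset.sum_congr rfl fun x _ => ?_
        rw [← h x, Multiset.card_cons]
        field_simp
        ring
      rw [h2, ← Finset.mul_sum]
      field_simp
      ring
    · have h3 : ∀ (t : P × G) (F : G → ℝ), (∑ x : G, if t = (bar p, x⁻¹) then F x else 0) =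
          if t.1 = bar p then F t.2⁻¹ else 0 := by
        intro t F
        rw [Finset.sum_eq_single t.2⁻¹]
        · simp [Prod.ext_iff]
        · intro x _ hx
          rw [if_neg]
          rintro rfl
          simp at hx
        · simp
      simp only [h3, removalSum]
      rw [← Multiset.sum_map_mul_left, ← Multiset.sum_map_mul_left]
      congr 1
      refine Multiset.map_congr rfl fun t ht => ?_
      split_ifs
      · have h4 := ih (u.erase t) (g * t.2⁻¹)
        rw [← Multiset.card_erase_add_one ht, pow_succ', mul_assoc, h4, List.length_cons, pow_succ',
          mul_assoc]
      · simp

/-- The number of matchings of `c + d` elements of a list and `a + b` elements of a multiset, which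
are not matched among themselves, where `a` and `c` elements have sign `+` and the other ones have
sign `-`, and only elements of different sign are matched. -/
def signedMatchCount (a b c d : ℕ) : ℕ :=
  if c + a = d + b then c.descFactorial b * d.factorial else 0

/-- In the closed form, `c.descFactorial b` places the b open negative elements among the c positive
ones, and `d.factorial` matches the d negative elements with all remaining positive ones. The
recursion follows the first positive element: it stays open or takes one of the b open negatives. -/
theorem signedMatchCount_succ_left (a b c d : ℕ) : signedMatchCount a b (c + 1) d =
    signedMatchCount (a + 1) b c d + b * signedMatchCount a (b - 1) c d := by
  unfold signedMatchCount
  rcases b with _ | b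
  · simp [add_assoc, add_comm 1 a]
  · by_cases h : c + 1 + a = d + (b + 1)
    · have h1 : c + (a + 1) = d + (b + 1) := by omega
      have h2 : c + a = d + (b + 1 - 1) := by omega
      rw [if_pos h, if_pos h1, if_pos h2, Nat.succ_descFactorial_succ, Nat.descFactorial_succ,
        Nat.add_sub_cancel]
      rcases le_or_gt b c with hbc | hbc
      · obtain ⟨k, rfl⟩ := Nat.exists_eq_add_of_le hbc
        rw [Nat.add_sub_cancel_left]
        ring
      · simp [Nat.descFactorial_of_lt hbc]
    · have h1 : ¬ c + (a + 1) = d + (b + 1) := by omega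
      have h2 : ¬ c + a = d + (b + 1 - 1) := by omega
      simp only [if_neg h, if_neg h1, if_neg h2, mul_zero, add_zero]

theorem signedMatchCount_succ_right (a b c d : ℕ) : signedMatchCount a b c (d + 1) =
    signedMatchCount a (b + 1) c d + a * signedMatchCount (a - 1) b c d := by
  unfold signedMatchCount
  by_cases h : c + a = d + 1 + b
  · have h1 : c + a = d + (b + 1) := by omega
    rw [if_pos h, if_pos h1, Nat.descFactorial_succ, Nat.factorial_succ]
    rcases le_or_gt b c with hbc | hbc
    · obtain ⟨k, rfl⟩ := Nat.exists_eq_add_of_le hbc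
      rw [Nat.add_sub_cancel_left, show d + 1 = k + a by omega]
      rcases a with _ | a
      · simp; ring
      · rw [if_pos (by omega)]
        ring
    · simp [Nat.descFactorial_of_lt hbc]
  · have h1 : ¬ c + a = d + (b + 1) := by omega
    rw [if_neg h, if_neg h1]
    rcases a with _ | a
    · simp
    · rw [if_neg (by omega), mul_zero, zero_add]

/-- The change of the sign of an element with a sign. -/
def flipSign {K : Type*} (s : K × Bool) : K × Bool := (s.1, !s.2)

/-- Only elements with the same key are matched, so the count factors over keys. For u = 0 the
factors are δ_{ab} a!, the mixed moments of a standard complex Gaussian. -/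
theorem matchCount_flipSign {K : Type*} [Fintype K] [DecidableEq K] (l : List (K × Bool)) :
    ∀ u : Multiset (K × Bool), matchCount flipSign l u =
      ∏ k, signedMatchCount (u.count (k, false)) (u.count (k, true)) (l.count (k, false))
        (l.count (k, true)) := by
  induction l with
  | nil =>
    intro u
    rw [matchCount]
    split_ifs with hu
    · simp [hu, signedMatchCount]
    · obtain ⟨⟨k, b⟩, hs⟩ := Multiset.exists_mem_of_ne_zero hu
      symm
      refine Finset.prod_eq_zero (Finset.mem_univ k) ?_
      have := Multiset.count_pos.2 hs
      rw [signedMatchCount, List.count_nil, List.count_nil]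
      split_ifs with h
      · cases b
        · rw [Nat.descFactorial_of_lt (by omega), zero_mul]
        · rw [Nat.descFactorial_of_lt (by omega), zero_mul]
      · rfl
  | cons s l ih =>
    intro u
    obtain ⟨k, b⟩ := s
    rw [matchCount, removalSum_ite, ih, ih]
    rw [← Finset.mul_prod_erase _ _ (Finset.mem_univ k), ← Finset.mul_prod_erase _ _ (Finset.mem_univ k),
      ← Finset.mul_prod_erase _ _ (Finset.mem_univ k), ← mul_assoc]
    have e1 : ∀ k' ∈ Finset.univ.erase k,
        signedMatchCount (((k, b) ::ₘ u).count (k', false)) (((k, b) ::ₘ u).count (k', true))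
          (l.count (k', false)) (l.count (k', true)) =
        signedMatchCount (u.count (k', false)) (u.count (k', true))
          (l.count (k', false)) (l.count (k', true)) := by
      intro k' hk'
      have hne : k' ≠ k := Finset.ne_of_mem_erase hk'
      simp [hne]
    have e2 : ∀ k' ∈ Finset.univ.erase k,
        signedMatchCount ((u.erase (flipSign (k, b))).count (k', false))
          ((u.erase (flipSign (k, b))).count (k', true))
          (l.count (k', false)) (l.count (k', true)) =
        signedMatchCount (u.count (k', false)) (u.count (k', true))
          (l.count (k', false)) (l.count (k', true)) := by
      intro k' hk'
      have hne : k' ≠ k := Finset.ne_of_mem_erase hk'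
      simp [flipSign, hne]
    have e3 : ∀ k' ∈ Finset.univ.erase k,
        signedMatchCount (u.count (k', false)) (u.count (k', true))
          (((k, b) :: l).count (k', false)) (((k, b) :: l).count (k', true)) =
        signedMatchCount (u.count (k', false)) (u.count (k', true))
          (l.count (k', false)) (l.count (k', true)) := by
      intro k' hk'
      have hne : k ≠ k' := (Finset.ne_of_mem_erase hk').symm
      simp [hne]
    rw [Finset.prod_congr rfl e1, Finset.prod_congr rfl e2, Finset.prod_congr rfl e3, ← add_mul]
    congr 1
    cases b
    · have h1 : (flipSign (k, false) : K × Bool) = (k, true) := rfl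
      rw [h1]
      simp [Multiset.count_erase_self, signedMatchCount_succ_left]
    · have h1 : (flipSign (k, true) : K × Bool) = (k, false) := rfl
      rw [h1]
      simp [Multiset.count_erase_self, signedMatchCount_succ_right]

/-- Sums over words are dominated by words with few distinct keys: `x ↦ key p x` is injective for
every letter `p`. -/
theorem wordSum_inv_card_keys_le {P G K : Type*} [Fintype G] [Nonempty G] [DecidableEq K]
    {key : P × G → K} (hkey : ∀ p, Function.Injective fun x => key (p, x)) (w : List P) :
    ∀ S : Finset K,
    wordSum w (fun l : List (P × G) =>
      ((Fintype.card G : ℝ)⁻¹) ^ (S ∪ (l.map key).toFinset).card) ≤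
      (w.length + S.card + 1 : ℝ) ^ w.length * ((Fintype.card G : ℝ)⁻¹) ^ S.card := by
  have hcard : (0 : ℝ) < Fintype.card G := Nat.cast_pos.2 Fintype.card_pos
  set r := (Fintype.card G : ℝ)⁻¹ with hr
  have hr0 : 0 < r := inv_pos.2 hcard
  induction w with
  | nil => intro S; simp [wordSum]
  | cons p w ih =>
    intro S
    -- A fresh key gains a factor 1/|G|, which compensates the |G| choices of x; a repeated key
    -- gains nothing but leaves at most |S| choices. Together they give the factor 1 + |S|.
    have h : ∀ x : G, wordSum w (fun l : List (P × G) =>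
        r ^ (S ∪ (((p, x) :: l).map key).toFinset).card) ≤
        ((w.length + 1 : ℕ) + S.card + 1 : ℝ) ^ w.length * (r ^ S.card * r) +
        if key (p, x) ∈ S then
          ((w.length + 1 : ℕ) + S.card + 1 : ℝ) ^ w.length * r ^ S.card else 0 := by
      intro x
      have e : ∀ l : List (P × G), S ∪ (((p, x) :: l).map key).toFinset =
          insert (key (p, x)) S ∪ (l.map key).toFinset := by
        intro l
        rw [List.map_cons, List.toFinset_cons, Finset.insert_union, Finset.union_insert]
      simp only [e]
      refine (ih _).trans ?_
      split_ifs with hx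
      · rw [Finset.insert_eq_of_mem hx]
        refine (mul_le_mul_of_nonneg_right (pow_le_pow_left₀ (by positivity) ?_ _)
          (by positivity)).trans (le_add_of_nonneg_left (by positivity))
        push_cast; linarith
      · rw [Finset.card_insert_of_notMem hx, pow_succ, add_zero]
        refine mul_le_mul_of_nonneg_right (pow_le_pow_left₀ (by positivity) ?_ _) (by positivity)
        push_cast; linarith
    rw [wordSum]
    refine (Finset.sum_le_sum fun x _ => h x).trans ?_
    rw [Finset.sum_add_distrib, Finset.sum_const, ← Finset.sum_filter, Finset.sum_const,
      nsmul_eq_mul, nsmul_eq_mul, Finset.card_univ]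
    have hS : ((Finset.univ.filter fun x : G => key (p, x) ∈ S).card : ℝ) ≤ S.card := by
      refine Nat.cast_le.2 (Finset.card_le_card_of_injOn (fun x => key (p, x)) ?_
        (hkey p).injOn)
      intro x hx
      simpa using hx
    have h1 : (Fintype.card G : ℝ) * r = 1 := mul_inv_cancel₀ hcard.ne'
    rw [List.length_cons, pow_succ]
    set A := ((w.length + 1 : ℕ) + S.card + 1 : ℝ) ^ w.length with hA
    have hA0 : 0 ≤ A := by positivity
    calc (Fintype.card G : ℝ) * (A * (r ^ S.card * r)) +
        ((Finset.univ.filter fun x : G => key (p, x) ∈ S).card : ℝ) * (A * r ^ S.card)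
        ≤ A * r ^ S.card * (Fintype.card G * r) + S.card * (A * r ^ S.card) := by
          have := mul_le_mul_of_nonneg_right hS (show 0 ≤ A * r ^ S.card by positivity)
          linarith
      _ = A * (1 + S.card) * r ^ S.card := by rw [h1]; ring
      _ ≤ _ := by
          refine mul_le_mul_of_nonneg_right (mul_le_mul_of_nonneg_left ?_ hA0) (by positivity)
          push_cast
          linarith [(Nat.cast_nonneg w.length : (0 : ℝ) ≤ w.length)]

end Matchings

/-! ### Moments of the random matrices and comparison with the pairing count. -/

section Moments

/-- The random variable `f` has finite moments of all orders. -/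
def HasAllMoments {Ω : Type*} [MeasurableSpace Ω] (f : Ω → ℂ) (μ : Measure Ω) : Prop :=
  ∀ p : ℕ, MemLp f p μ

theorem hasAllMoments_const {Ω : Type*} [MeasurableSpace Ω] {μ : Measure Ω} [IsFiniteMeasure μ]
    (c : ℂ) : HasAllMoments (fun _ : Ω => c) μ := fun _ => memLp_const c

theorem HasAllMoments.add {Ω : Type*} [MeasurableSpace Ω] {μ : Measure Ω} {f g : Ω → ℂ}
    (hf : HasAllMoments f μ) (hg : HasAllMoments g μ) : HasAllMoments (fun ω => f ω + g ω) μ :=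
  fun p => (hf p).add (hg p)

theorem HasAllMoments.mul {Ω : Type*} [MeasurableSpace Ω] {μ : Measure Ω} {f g : Ω → ℂ}
    (hf : HasAllMoments f μ) (hg : HasAllMoments g μ) : HasAllMoments (fun ω => f ω * g ω) μ := by
  intro p
  have h : ENNReal.HolderTriple ((2 * p : ℕ) : ENNReal) ((2 * p : ℕ) : ENNReal) (p : ENNReal) := by
    constructor
    push_cast
    rw [ENNReal.mul_inv (by simp) (by simp), ← add_mul, ENNReal.inv_two_add_inv_two, one_mul]
  exact (hg (2 * p)).mul' (hf (2 * p))

theorem HasAllMoments.star {Ω : Type*} [MeasurableSpace Ω] {μ : Measure Ω} {f : Ω → ℂ}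
    (hf : HasAllMoments f μ) : HasAllMoments (fun ω => star (f ω)) μ :=
  fun p => (hf p).star

theorem HasAllMoments.sum {Ω ι : Type*} [MeasurableSpace Ω] {μ : Measure Ω} (s : Finset ι)
    {f : ι → Ω → ℂ} (hf : ∀ i, HasAllMoments (f i) μ) :
    HasAllMoments (fun ω => ∑ i ∈ s, f i ω) μ :=
  fun p => memLp_finsetSum s fun i _ => hf i p

theorem HasAllMoments.list_prod {Ω S : Type*} [MeasurableSpace Ω] {μ : Measure Ω}
    [IsFiniteMeasure μ] {f : S → Ω → ℂ} (hf : ∀ s, HasAllMoments (f s) μ) (l : List S) :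
    HasAllMoments (fun ω => (l.map fun s => f s ω).prod) μ := by
  induction l with
  | nil => simpa using hasAllMoments_const 1
  | cons s l ih => simpa using (hf s).mul ih

theorem HasAllMoments.integrable {Ω : Type*} [MeasurableSpace Ω] {μ : Measure Ω} {f : Ω → ℂ}
    (hf : HasAllMoments f μ) : Integrable f μ := by
  rw [← memLp_one_iff_integrable]
  exact_mod_cast hf 1

/-- The kernel of the convolution operator with the function `X i`, for `(i, false)`, or of its
adjoint, for `(i, true)`. -/
def convKernel {G Ω ι : Type*} [Group G] (X : ι → G → Ω → ℂ) (p : ι × Bool) (x : G) (ω : Ω) : ℂ :=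
  cond p.2 (star (X p.1 x⁻¹ ω)) (X p.1 x ω)

theorem withAdjoints_randomConvMatrix {G Ω ι : Type*} [Group G] [Fintype G] (X : ι → G → Ω → ℂ)
    (p : ι × Bool) (ω : Ω) :
    withAdjoints (fun i => randomConvMatrix (X i)) p ω =
      ((√(Fintype.card G : ℝ) : ℝ) : ℂ)⁻¹ • convMatrix fun x => convKernel X p x ω := by
  obtain ⟨i, b⟩ := p
  cases b
  · simp only [withAdjoints, randomConvMatrix, Nat.card_eq_fintype_card]
    rfl
  · simp only [withAdjoints, randomConvMatrix, Nat.card_eq_fintype_card, Pi.star_apply, star_smul]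
    congr 1
    · simp
    · ext h g
      simp [convMatrix, convKernel, Matrix.star_apply]

/-- Paths of matrix indices are described by their increments, whose product is fixed by the two
endpoints. -/
theorem prod_convMatrix_apply {P G : Type*} [Group G] [Fintype G] [DecidableEq G] (f : P → G → ℂ)
    (w : List P) : ∀ h g : G, (w.map fun p => convMatrix (f p)).prod h g =
      wordSum w fun l => if (l.map Prod.snd).prod = h * g⁻¹ then
        (l.map fun s => f s.1 s.2).prod else 0 := by
  induction w with
  | nil =>
    intro h g
    simp only [List.map_nil, List.prod_nil, wordSum, Matrix.one_apply]
    congr 1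
    rw [eq_comm (a := (1 : G)), mul_inv_eq_one]
  | cons p w ih =>
    intro h g
    rw [List.map_cons, List.prod_cons, Matrix.mul_apply, wordSum]
    -- The intermediate index is k = x⁻¹ h, so that the increment h k⁻¹ is x.
    refine (Fintype.sum_equiv ((Equiv.inv G).trans (Equiv.mulRight h)) _ _ fun x => ?_).symm
    have e : convMatrix (f p) h (((Equiv.inv G).trans (Equiv.mulRight h)) x) = f p x := by
      simp [convMatrix]
    rw [e, ih, mul_wordSum]
    congr 1
    ext l
    simp only [List.map_cons, List.prod_cons, Equiv.trans_apply, Equiv.inv_apply,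
      Equiv.coe_mulRight, mul_ite, mul_zero]
    congr 1
    rw [mul_assoc, eq_inv_mul_iff_mul_eq]

theorem prod_smul_list {P A : Type*} [Ring A] [Algebra ℂ A] (c : ℂ) (f : P → A) (w : List P) :
    (w.map fun p => c • f p).prod = c ^ w.length • (w.map f).prod := by
  induction w with
  | nil => simp
  | cons p w ih =>
    rw [List.map_cons, List.prod_cons, ih, List.map_cons, List.prod_cons, List.length_cons,
      pow_succ', smul_mul_smul_comm]

/-- All diagonal entries of a product of convolution matrices agree, since the condition on the
increments is that their product be 1; their number cancels the normalization of the trace. -/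
theorem expectedTrace_word {G Ω ι : Type*} [Group G] [Fintype G] [DecidableEq G]
    [MeasurableSpace Ω] {μ : Measure Ω} [IsFiniteMeasure μ] {X : ι → G → Ω → ℂ}
    (hX : ∀ i g, HasAllMoments (X i g) μ) (w : List (ι × Bool)) :
    expectedTrace μ (w.map (withAdjoints fun i => randomConvMatrix (X i))).prod =
      (((√(Fintype.card G : ℝ) : ℝ) : ℂ)⁻¹) ^ w.length * wordSum w fun l : List ((ι × Bool) × G) =>
        if (l.map Prod.snd).prod = 1 then
          ∫ ω, (l.map fun s => convKernel X s.1 s.2 ω).prod ∂μ else 0 := by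
  have hcard : (Fintype.card G : ℂ) ≠ 0 := Nat.cast_ne_zero.2 Fintype.card_ne_zero
  have hK : ∀ s : (ι × Bool) × G, HasAllMoments (fun ω => convKernel X s.1 s.2 ω) μ := by
    rintro ⟨⟨i, b⟩, x⟩
    cases b
    · exact hX i x
    · exact (hX i x⁻¹).star
  have htrace : ∀ ω, ((w.map (withAdjoints fun i => randomConvMatrix (X i))).prod ω).trace =
      Fintype.card G * ((((√(Fintype.card G : ℝ) : ℝ) : ℂ)⁻¹) ^ w.length *
        wordSum w fun l : List ((ι × Bool) × G) => if (l.map Prod.snd).prod = 1 then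
          (l.map fun s => convKernel X s.1 s.2 ω).prod else 0) := by
    intro ω
    have e : (w.map (withAdjoints fun i => randomConvMatrix (X i))).prod ω =
        (w.map fun p => ((√(Fintype.card G : ℝ) : ℝ) : ℂ)⁻¹ •
          convMatrix fun x => convKernel X p x ω).prod := by
      have := map_list_prod (Pi.evalMonoidHom (fun _ : Ω => Matrix G G ℂ) ω)
        (w.map (withAdjoints fun i => randomConvMatrix (X i)))
      rw [List.map_map] at this
      refine this.trans ?_
      congr 1
      refine List.map_congr_left fun p _ => ?_
      exact withAdjoints_randomConvMatrix X p ω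
    rw [e, prod_smul_list, Matrix.trace_smul, Matrix.trace]
    simp only [Matrix.diag_apply, prod_convMatrix_apply, mul_inv_cancel]
    rw [Finset.sum_const, Finset.card_univ, nsmul_eq_mul, smul_eq_mul]
    ring
  have hint : ∀ (w : List (ι × Bool)) (f : List ((ι × Bool) × G) → Ω → ℂ),
      (∀ l, Integrable (f l) μ) → Integrable (fun ω => wordSum w fun l => f l ω) μ ∧
      ∫ ω, (wordSum w fun l => f l ω) ∂μ = wordSum w fun l => ∫ ω, f l ω ∂μ := by
    intro w
    induction w with
    | nil => intro f hf; exact ⟨hf [], rfl⟩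
    | cons p w ih =>
      intro f hf
      have h := fun x => ih (fun l => f ((p, x) :: l)) fun l => hf _
      refine ⟨integrable_finsetSum _ fun x _ => (h x).1, ?_⟩
      simp only [wordSum]
      rw [integral_finsetSum _ fun x _ => (h x).1]
      exact Finset.sum_congr rfl fun x _ => (h x).2
  rw [expectedTrace, integral_congr_ae (Eventually.of_forall htrace), integral_const_mul,
    integral_const_mul, ← mul_assoc, inv_mul_cancel₀ hcard, one_mul, (hint w _ _).2]
  · congr 2
    ext l
    split_ifs
    · rfl
    · simp
  · intro l
    split_ifs
    · exact (HasAllMoments.list_prod hK l).integrable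
    · exact integrable_zero _ _ _

theorem integrable_trace_lift {G Ω ι : Type*} [Group G] [Fintype G] [DecidableEq G]
    [MeasurableSpace Ω] {μ : Measure Ω} [IsFiniteMeasure μ] {X : ι → G → Ω → ℂ}
    (hX : ∀ i g, HasAllMoments (X i g) μ) (Q : FreeAlgebra ℂ (ι × Bool)) :
    Integrable (fun ω => (FreeAlgebra.lift ℂ
      (withAdjoints fun i => randomConvMatrix (X i)) Q ω).trace) μ := by
  have h : ∀ h g : G, HasAllMoments (fun ω => FreeAlgebra.lift ℂ
      (withAdjoints fun i => randomConvMatrix (X i)) Q ω h g) μ := by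
    induction Q using FreeAlgebra.induction with
    | grade0 r =>
      intro h g
      simp only [AlgHom.commutes]
      exact hasAllMoments_const _
    | grade1 p =>
      intro h g
      simp only [FreeAlgebra.lift_ι_apply, withAdjoints_randomConvMatrix, Matrix.smul_apply,
        smul_eq_mul]
      refine (hasAllMoments_const _).mul ?_
      obtain ⟨i, b⟩ := p
      cases b
      · exact hX i _
      · exact (hX i _).star
    | mul a b ha hb =>
      intro h g
      simp only [map_mul, Pi.mul_apply, Matrix.mul_apply]
      exact HasAllMoments.sum _ fun k => (ha h k).mul (hb k g)
    | add a b ha hb =>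
      intro h g
      simp only [map_add, Pi.add_apply, Matrix.add_apply]
      exact (ha h g).add (hb h g)
  exact (HasAllMoments.sum _ fun g => h g g).integrable

/-- The pair of the variable and the sign which correspond to an entry of a convolution matrix or of
its adjoint. -/
def signedKey {G ι : Type*} [Group G] (s : (ι × Bool) × G) : (ι × G) × Bool :=
  ((s.1.1, cond s.1.2 s.2⁻¹ s.2), s.1.2)

theorem signedKey_injective {G ι : Type*} [Group G] :
    Function.Injective (signedKey : (ι × Bool) × G → (ι × G) × Bool) := by
  rintro ⟨⟨i, b⟩, x⟩ ⟨⟨j, c⟩, y⟩ h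
  simp only [signedKey, Prod.mk.injEq] at h ⊢
  obtain ⟨⟨rfl, h⟩, rfl⟩ := h
  cases b <;> simpa using h

theorem signedKey_labelledInv {G ι : Type*} [Group G] (s : (ι × Bool) × G) :
    signedKey (labelledInv adjointIndex s) = flipSign (signedKey s) := by
  obtain ⟨⟨i, b⟩, x⟩ := s
  cases b <;> simp [signedKey, labelledInv, adjointIndex, flipSign]

/-- The mixed moments of a complex random variable and its conjugate. -/
def mixedMoment {Ω : Type*} [MeasurableSpace Ω] (ξ : Ω → ℂ) (μ : Measure Ω) (a b : ℕ) : ℂ :=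
  ∫ ω, ξ ω ^ a * star (ξ ω) ^ b ∂μ

theorem list_prod_map_signed {K : Type*} [Fintype K] [DecidableEq K] (z : K → ℂ)
    (l : List (K × Bool)) : (l.map fun s => cond s.2 (star (z s.1)) (z s.1)).prod =
      ∏ k, z k ^ l.count (k, false) * star (z k) ^ l.count (k, true) := by
  induction l with
  | nil => simp
  | cons s l ih =>
    obtain ⟨k, b⟩ := s
    have e : cond b (star (z k)) (z k) =
        ∏ k', if k' = k then cond b (star (z k)) (z k) else 1 := by simp
    rw [List.map_cons, List.prod_cons, ih]
    change cond b (star (z k)) (z k) * _ = _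
    rw [e, ← Finset.prod_mul_distrib]
    refine Finset.prod_congr rfl fun k' _ => ?_
    by_cases hk : k' = k
    · subst hk
      cases b
      · simp [pow_succ]; ring
      · simp [pow_succ]; ring
    · simp [hk, Ne.symm hk]

theorem integral_prod_signed {Ω Ω₀ K : Type*} [Fintype K] [DecidableEq K] [MeasurableSpace Ω]
    [MeasurableSpace Ω₀] {μ : Measure Ω} {μ₀ : Measure Ω₀} {Z : K → Ω → ℂ} {ξ : Ω₀ → ℂ}
    (hd : ∀ k, IdentDistrib (Z k) ξ μ μ₀) (hindep : iIndepFun Z μ) (l : List (K × Bool)) :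
    ∫ ω, (l.map fun s => cond s.2 (star (Z s.1 ω)) (Z s.1 ω)).prod ∂μ =
      ∏ k, mixedMoment ξ μ₀ (l.count (k, false)) (l.count (k, true)) := by
  have hc : ∀ a b : ℕ, Continuous fun z : ℂ => z ^ a * star z ^ b := fun a b => by fun_prop
  rw [integral_congr_ae (Eventually.of_forall fun ω => list_prod_map_signed (fun k => Z k ω) l)]
  rw [hindep.integral_fun_prod_comp (f := fun k z => z ^ l.count (k, false) *
    star z ^ l.count (k, true)) (fun k => (hd k).aemeasurable_fst)
    (fun k => (hc _ _).aestronglyMeasurable)]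
  refine Finset.prod_congr rfl fun k _ => ?_
  exact ((hd k).comp (hc _ _).measurable).integral_eq

theorem prod_convKernel_eq {G Ω ι : Type*} [Group G] (X : ι → G → Ω → ℂ)
    (l : List ((ι × Bool) × G)) (ω : Ω) :
    (l.map fun s => convKernel X s.1 s.2 ω).prod =
      ((l.map signedKey).map fun s => cond s.2 (star (X s.1.1 s.1.2 ω)) (X s.1.1 s.1.2 ω)).prod := by
  rw [List.map_map]
  congr 1
  refine List.map_congr_left fun s _ => ?_
  obtain ⟨⟨i, b⟩, x⟩ := s
  cases b <;> rfl

theorem count_map_fst {K : Type*} [DecidableEq K] (l : List (K × Bool)) (k : K) :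
    (l.map Prod.fst).count k = l.count (k, false) + l.count (k, true) := by
  induction l with
  | nil => simp
  | cons s l ih =>
    obtain ⟨k', b⟩ := s
    rw [List.map_cons, List.count_cons, ih, List.count_cons, List.count_cons]
    by_cases hk : k' = k
    · cases b <;> simp [hk] <;> ring
    · simp [hk]

/-- If some key occurs exactly once, both terms vanish; if no key occurs more than twice, they
agree, because the moments up to order two do. Otherwise there are fewer than n/2 distinct keys, the
last factor is at least 1, and crude bounds suffice. With q² = |G| that factor has the form summed
by `wordSum_inv_card_keys_le`. -/
theorem norm_prod_moment_sub_matchCount_le {K : Type*} [Fintype K] [DecidableEq K]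
    {M : ℕ → ℕ → ℂ} (h00 : M 0 0 = 1) (h10 : M 1 0 = 0) (h01 : M 0 1 = 0) (h20 : M 2 0 = 0)
    (h02 : M 0 2 = 0) (h11 : M 1 1 = 1) {n : ℕ} {B : ℝ} (hB : 1 ≤ B)
    (hM : ∀ a b, a + b ≤ n → ‖M a b‖ ≤ B)
    (hs : ∀ a b, a + b ≤ n → (signedMatchCount 0 0 a b : ℝ) ≤ B) {q : ℝ} (hq : 1 ≤ q)
    (l : List (K × Bool)) (hl : l.length = n) :
    ‖(∏ k, M (l.count (k, false)) (l.count (k, true))) - (matchCount flipSign l 0 : ℂ)‖ ≤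
      2 * B ^ n * (q ^ n * q⁻¹ * ((q ^ 2)⁻¹) ^ (l.map Prod.fst).toFinset.card) := by
  have hq0 : 0 < q := one_pos.trans_le hq
  have hrhs : 0 ≤ 2 * B ^ n *
      (q ^ n * q⁻¹ * ((q ^ 2)⁻¹) ^ (l.map Prod.fst).toFinset.card) := by positivity
  rw [matchCount_flipSign]
  simp only [Multiset.count_zero]
  set S := (l.map Prod.fst).toFinset with hS
  have hcount := count_map_fst l
  have hle : ∀ k, l.count (k, false) + l.count (k, true) ≤ n := by
    intro k
    rw [← hcount k, ← hl, ← List.length_map (f := Prod.fst) (as := l)]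
    exact List.count_le_length
  have hout : ∀ k ∉ S, l.count (k, false) = 0 ∧ l.count (k, true) = 0 := by
    intro k hk
    rw [hS, List.mem_toFinset] at hk
    have := List.count_eq_zero_of_not_mem hk
    rw [hcount] at this
    omega
  have hsum : ∑ k ∈ S, (l.count (k, false) + l.count (k, true)) = n := by
    rw [← hl, ← List.length_map (f := Prod.fst) (as := l), ← List.sum_toFinset_count_eq_length]
    exact Finset.sum_congr rfl fun k _ => (hcount k).symm
  have hSn : S.card ≤ n := by
    rw [← hl, ← List.length_map (f := Prod.fst) (as := l)]
    exact List.toFinset_card_le _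
  by_cases h1 : ∃ k, l.count (k, false) + l.count (k, true) = 1
  · obtain ⟨k, hk⟩ := h1
    rw [Finset.prod_eq_zero (Finset.mem_univ k), Finset.prod_eq_zero (Finset.mem_univ k)]
    · simpa using hrhs
    · rcases (by omega : (l.count (k, false) = 1 ∧ l.count (k, true) = 0) ∨
        (l.count (k, false) = 0 ∧ l.count (k, true) = 1)) with ⟨h, h'⟩ | ⟨h, h'⟩
      · simp [h, h', signedMatchCount]
      · simp [h, h', signedMatchCount]
    · rcases (by omega : (l.count (k, false) = 1 ∧ l.count (k, true) = 0) ∨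
        (l.count (k, false) = 0 ∧ l.count (k, true) = 1)) with ⟨h, h'⟩ | ⟨h, h'⟩
      · rw [h, h', h10]
      · rw [h, h', h01]
  by_cases h2 : ∀ k, l.count (k, false) + l.count (k, true) ≤ 2
  · have : ∏ k, M (l.count (k, false)) (l.count (k, true)) =
        ((∏ k, signedMatchCount 0 0 (l.count (k, false)) (l.count (k, true)) : ℕ) : ℂ) := by
      push_cast
      refine Finset.prod_congr rfl fun k _ => ?_
      have hk2 := h2 k
      have hk1 : l.count (k, false) + l.count (k, true) ≠ 1 := fun h => h1 ⟨k, h⟩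
      generalize l.count (k, false) = a at *
      generalize l.count (k, true) = b at *
      rcases (by omega : (a = 0 ∧ b = 0) ∨ (a = 2 ∧ b = 0) ∨ (a = 1 ∧ b = 1) ∨ (a = 0 ∧ b = 2))
        with ⟨rfl, rfl⟩ | ⟨rfl, rfl⟩ | ⟨rfl, rfl⟩ | ⟨rfl, rfl⟩
      · simp [h00, signedMatchCount]
      · simp [h20, signedMatchCount]
      · simp [h11, signedMatchCount]
      · simp [h02, signedMatchCount]
    rw [this, sub_self, norm_zero]
    exact hrhs
  · push Not at h2
    obtain ⟨k₀, hk₀⟩ := h2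
    have hk₀S : k₀ ∈ S := by
      by_contra h
      have := hout k₀ h
      omega
    -- Every key in S occurs at least twice and k₀ at least three times.
    have hlt : 2 * S.card < n := by
      rw [← hsum, mul_comm, ← smul_eq_mul, ← Finset.sum_const]
      refine Finset.sum_lt_sum (fun k hk => ?_) ⟨k₀, hk₀S, hk₀⟩
      have h3 : l.count (k, false) + l.count (k, true) ≠ 1 := fun h => h1 ⟨k, h⟩
      have h4 : 0 < (l.map Prod.fst).count k := List.count_pos_iff.2 (List.mem_toFinset.1 hk)
      rw [hcount] at h4
      omega
    have hpow : 1 ≤ q ^ n * q⁻¹ * ((q ^ 2)⁻¹) ^ S.card := by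
      rw [inv_pow, ← pow_mul, mul_assoc, ← mul_inv, ← pow_succ', ← div_eq_mul_inv,
        one_le_div (by positivity)]
      exact pow_le_pow_right₀ hq hlt
    have hA : ‖∏ k, M (l.count (k, false)) (l.count (k, true))‖ ≤ B ^ n := by
      rw [← Finset.prod_subset (Finset.subset_univ S) fun k _ hk => by
        rw [(hout k hk).1, (hout k hk).2, h00], norm_prod]
      refine (Finset.prod_le_prod (fun _ _ => norm_nonneg _) fun k _ => hM _ _ (hle k)).trans ?_
      rw [Finset.prod_const]
      exact pow_le_pow_right₀ hB hSn
    have hB' : ‖((∏ k, signedMatchCount 0 0 (l.count (k, false)) (l.count (k, true)) : ℕ) : ℂ)‖ ≤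
        B ^ n := by
      rw [Complex.norm_natCast, Nat.cast_prod]
      rw [← Finset.prod_subset (Finset.subset_univ S) fun k _ hk => by
        rw [(hout k hk).1, (hout k hk).2]; simp [signedMatchCount]]
      refine (Finset.prod_le_prod (fun _ _ => Nat.cast_nonneg _) fun k _ => hs _ _ (hle k)).trans ?_
      rw [Finset.prod_const]
      exact pow_le_pow_right₀ hB hSn
    calc _ ≤ B ^ n + B ^ n := (norm_sub_le _ _).trans (add_le_add hA hB')
      _ = 2 * B ^ n * 1 := by ring
      _ ≤ _ := mul_le_mul_of_nonneg_left hpow (by positivity)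

/-- The moments of random convolution matrices approximately count noncrossing pairings. -/
theorem norm_expectedTrace_sub_stackCount_le {G Ω Ω₀ ι : Type*} [Fintype ι] [DecidableEq ι]
    [Group G] [Fintype G] [DecidableEq G] [MeasurableSpace Ω] [MeasurableSpace Ω₀] {μ : Measure Ω}
    [IsFiniteMeasure μ] {μ₀ : Measure Ω₀} {X : ι → G → Ω → ℂ} {ξ : Ω₀ → ℂ}
    (hX : ∀ i g, HasAllMoments (X i g) μ) (hd : ∀ i g, IdentDistrib (X i g) ξ μ μ₀)
    (hindep : iIndepFun (fun p : ι × G => X p.1 p.2) μ) (h00 : mixedMoment ξ μ₀ 0 0 = 1)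
    (h10 : mixedMoment ξ μ₀ 1 0 = 0) (h01 : mixedMoment ξ μ₀ 0 1 = 0)
    (h20 : mixedMoment ξ μ₀ 2 0 = 0) (h02 : mixedMoment ξ μ₀ 0 2 = 0)
    (h11 : mixedMoment ξ μ₀ 1 1 = 1) (w : List (ι × Bool)) {B : ℝ} (hB : 1 ≤ B)
    (hM : ∀ a b, a + b ≤ w.length → ‖mixedMoment ξ μ₀ a b‖ ≤ B)
    (hs : ∀ a b, a + b ≤ w.length → (signedMatchCount 0 0 a b : ℝ) ≤ B) :
    ‖expectedTrace μ (w.map (withAdjoints fun i => randomConvMatrix (X i))).prod -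
      (stackCount adjointIndex w [] : ℂ)‖ ≤
    2 * B ^ w.length * (w.length + 1 : ℝ) ^ w.length * (√(Fintype.card G : ℝ))⁻¹ +
      crossingCount w.length 0 * commProb G := by
  have hcard : (1 : ℝ) ≤ Fintype.card G := by exact_mod_cast Fintype.card_pos
  set q := √(Fintype.card G : ℝ) with hqdef
  have hq : 1 ≤ q := Real.one_le_sqrt.2 hcard
  have hq0 : 0 < q := one_pos.trans_le hq
  have hq2 : q ^ 2 = Fintype.card G := Real.sq_sqrt (by positivity)
  have hV := wordSum_matchCount (G := G) adjointIndex w 0 1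
  simp only [Multiset.card_zero, pow_zero, one_mul] at hV
  have hW := abs_assignmentMean_sub_stackCount_le (G := G) adjointIndex w []
  simp only [assignmentMean, Multiset.coe_nil, List.length_nil, reverseProd, List.map_nil,
    List.reverse_nil, List.prod_nil] at hW
  have e1 : ((pairingMean adjointIndex w (0 : Multiset ((ι × Bool) × G)) 1 : ℝ) : ℂ) =
      (((q : ℝ) : ℂ)⁻¹) ^ w.length * wordSum w fun l : List ((ι × Bool) × G) =>
        if (l.map Prod.snd).prod = 1 then (matchCount (labelledInv adjointIndex) l 0 : ℂ) else 0 := by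
    have h3 : pairingMean adjointIndex w (0 : Multiset ((ι × Bool) × G)) 1 =
        (q⁻¹) ^ w.length * wordSum w fun l : List ((ι × Bool) × G) =>
        if (l.map Prod.snd).prod = 1 then (matchCount (labelledInv adjointIndex) l 0 : ℝ) else 0 := by
      rw [hV, ← mul_assoc, ← mul_pow, inv_mul_cancel₀ hq0.ne', one_pow, one_mul]
    rw [h3, Complex.ofReal_mul, Complex.ofReal_pow, Complex.ofReal_inv]
    congr 1
    refine (map_wordSum Complex.ofRealHom w _).trans ?_
    congr 1
    ext l
    split_ifs <;> simp
  have h4 : ‖expectedTrace μ (w.map (withAdjoints fun i => randomConvMatrix (X i))).prod -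
      ((pairingMean adjointIndex w (0 : Multiset ((ι × Bool) × G)) 1 : ℝ) : ℂ)‖ ≤
      2 * B ^ w.length * (w.length + 1 : ℝ) ^ w.length * q⁻¹ := by
    rw [expectedTrace_word hX, e1, ← mul_sub, norm_mul]
    have e2 : ∀ f g : List ((ι × Bool) × G) → ℂ, wordSum w f - wordSum w g =
        wordSum w fun l => f l - g l := by
      intro f g
      rw [sub_eq_iff_eq_add, ← wordSum_add]
      simp
    rw [e2]
    have h5 : ‖(((q : ℝ) : ℂ)⁻¹) ^ w.length‖ = (q⁻¹) ^ w.length := by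
      rw [norm_pow, norm_inv, Complex.norm_real, Real.norm_of_nonneg hq0.le]
    rw [h5]
    refine (mul_le_mul_of_nonneg_left ((norm_wordSum_le (G := G) w _).trans (wordSum_le w _
      (fun l : List ((ι × Bool) × G) => 2 * B ^ w.length * (q ^ w.length * q⁻¹) *
        ((Fintype.card G : ℝ)⁻¹) ^ (∅ ∪ (l.map fun s => (signedKey s).1).toFinset).card)
        fun l hl => ?_)) (by positivity)).trans ?_
    · split_ifs
      · simp only [prod_convKernel_eq]
        -- `signedKey` translates matching a letter with its labelled inverse into matching a
        -- variable with its conjugate, as the kernel of the adjoint at x is the conjugate of the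
        -- variable at x⁻¹.
        rw [integral_prod_signed (Z := fun p : ι × G => X p.1 p.2) (fun k => hd k.1 k.2) hindep,
          ← matchCount_map (barT := flipSign) signedKey_injective signedKey_labelledInv,
          Multiset.map_zero]
        have := norm_prod_moment_sub_matchCount_le h00 h10 h01 h20 h02 h11 hB hM hs hq
          (l.map signedKey) (by simpa using hl)
        rw [hq2, List.map_map] at this
        rw [Finset.empty_union]
        refine this.trans (le_of_eq ?_)
        simp only [Function.comp_def]
        ring
      · rw [sub_zero, norm_zero]
        positivity
    · rw [← mul_wordSum]
      have h7 := wordSum_inv_card_keys_le (G := G) (P := ι × Bool)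
        (key := fun s => (signedKey s).1) (fun p x y h => by
          have : signedKey (p, x) = signedKey (p, y) := Prod.ext h rfl
          exact (Prod.ext_iff.1 (signedKey_injective this)).2) w ∅
      refine (mul_le_mul_of_nonneg_left (mul_le_mul_of_nonneg_left h7 (by positivity))
        (by positivity)).trans (le_of_eq ?_)
      have h8 : (q⁻¹) ^ w.length * q ^ w.length = 1 := by
        rw [← mul_pow, inv_mul_cancel₀ hq0.ne', one_pow]
      simp only [Finset.card_empty, pow_zero, mul_one, CharP.cast_eq_zero, add_zero]
      linear_combination (2 * B ^ w.length * (w.length + 1 : ℝ) ^ w.length * q⁻¹) * h8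
  have h9 : ‖((pairingMean adjointIndex w (0 : Multiset ((ι × Bool) × G)) 1 : ℝ) : ℂ) -
      (stackCount adjointIndex w [] : ℂ)‖ ≤ crossingCount w.length 0 * commProb G := by
    rw [← Complex.ofReal_natCast, ← Complex.ofReal_sub, Complex.norm_real]
    exact hW
  calc _ ≤ _ := norm_sub_le_norm_sub_add_norm_sub _ _ _
    _ ≤ _ := add_le_add h4 h9

end Moments

/-! ### Passage to the limit and conclusion. -/

section Limit

theorem expectedTrace_add {Ω ι : Type*} [MeasurableSpace Ω] [Fintype ι] {μ : Measure Ω}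
    {M M' : Ω → Matrix ι ι ℂ} (h : Integrable (fun ω => (M ω).trace) μ)
    (h' : Integrable (fun ω => (M' ω).trace) μ) :
    expectedTrace μ (M + M') = expectedTrace μ M + expectedTrace μ M' := by
  simp only [expectedTrace, Pi.add_apply, Matrix.trace_add]
  rw [integral_add h h', mul_add]

theorem expectedTrace_smul {Ω ι : Type*} [MeasurableSpace Ω] [Fintype ι] {μ : Measure Ω} (c : ℂ)
    (M : Ω → Matrix ι ι ℂ) : expectedTrace μ (c • M) = c * expectedTrace μ M := by
  simp only [expectedTrace, Pi.smul_apply, Matrix.trace_smul, smul_eq_mul, integral_const_mul]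
  ring

/-- Bounded families of mixed moments and of numbers of matchings. -/
theorem exists_moment_bound (M : ℕ → ℕ → ℂ) (n : ℕ) : ∃ B : ℝ, 1 ≤ B ∧
    (∀ a b, a + b ≤ n → ‖M a b‖ ≤ B) ∧
    ∀ a b, a + b ≤ n → (signedMatchCount 0 0 a b : ℝ) ≤ B := by
  let F : ℕ × ℕ → ℝ := fun p => ‖M p.1 p.2‖ + signedMatchCount 0 0 p.1 p.2
  have hF : ∀ p, 0 ≤ F p := fun p => by positivity
  have h : ∀ a b, a + b ≤ n →
      F (a, b) ≤ 1 + ∑ p ∈ Finset.range (n + 1) ×ˢ Finset.range (n + 1), F p := by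
    intro a b hab
    have hmem : (a, b) ∈ Finset.range (n + 1) ×ˢ Finset.range (n + 1) := by
      rw [Finset.mem_product, Finset.mem_range, Finset.mem_range]
      constructor <;> omega
    have := Finset.single_le_sum (f := F) (fun p _ => hF p) hmem
    linarith
  refine ⟨1 + ∑ p ∈ Finset.range (n + 1) ×ˢ Finset.range (n + 1), F p,
    le_add_of_nonneg_right (Finset.sum_nonneg fun p _ => hF p), fun a b hab => ?_,
    fun a b hab => ?_⟩
  · exact (le_add_of_nonneg_right (Nat.cast_nonneg _)).trans (h a b hab)
  · exact (le_add_of_nonneg_left (norm_nonneg _)).trans (h a b hab)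

/-- The moments of random convolution matrices and their adjoints converge to the numbers of
noncrossing pairings. -/
theorem tendsto_expectedTrace_word
    (G : ℕ → Type*) [∀ N, Group (G N)] [∀ N, Fintype (G N)] [∀ N, DecidableEq (G N)]
    (hcard : Tendsto (fun N => Fintype.card (G N)) atTop atTop)
    (hcomm : Tendsto (fun N => (commProb (G N) : ℝ)) atTop (𝓝 0))
    {Ω₀ : Type*} [MeasurableSpace Ω₀] {P₀ : Measure Ω₀} [IsProbabilityMeasure P₀] {ξ : Ω₀ → ℂ}
    (hmean : ∫ ω, ξ ω ∂P₀ = 0) (hsq : ∫ ω, ξ ω ^ 2 ∂P₀ = 0) (hvar : ∫ ω, ‖ξ ω‖ ^ 2 ∂P₀ = 1)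
    {ι : Type*} [Fintype ι] [DecidableEq ι] (Ω : ℕ → Type*) [∀ N, MeasurableSpace (Ω N)]
    (P : ∀ N, Measure (Ω N)) [∀ N, IsProbabilityMeasure (P N)] (X : ∀ N, ι → G N → Ω N → ℂ)
    (hX : ∀ N i g, HasAllMoments (X N i g) (P N))
    (hdistrib : ∀ N i g, IdentDistrib (X N i g) ξ (P N) P₀)
    (hindep : ∀ N, iIndepFun (fun p : ι × G N => X N p.1 p.2) (P N)) (w : List (ι × Bool)) :
    Tendsto (fun N => expectedTrace (P N)
      (w.map (withAdjoints fun i => randomConvMatrix (X N i))).prod) atTop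
      (𝓝 (stackCount adjointIndex w [] : ℂ)) := by
  have h00 : mixedMoment ξ P₀ 0 0 = 1 := by simp [mixedMoment]
  have h10 : mixedMoment ξ P₀ 1 0 = 0 := by simpa [mixedMoment] using hmean
  have h20 : mixedMoment ξ P₀ 2 0 = 0 := by simpa [mixedMoment] using hsq
  have h01 : mixedMoment ξ P₀ 0 1 = 0 := by
    have := integral_conj (f := ξ) (μ := P₀)
    rw [hmean, map_zero] at this
    simpa [mixedMoment] using this
  have h02 : mixedMoment ξ P₀ 0 2 = 0 := by
    have := integral_conj (f := fun ω => ξ ω ^ 2) (μ := P₀)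
    rw [hsq, map_zero] at this
    simpa [mixedMoment] using this
  have h11 : mixedMoment ξ P₀ 1 1 = 1 := by
    have e : ∀ ω, ξ ω ^ 1 * star (ξ ω) ^ 1 = ((‖ξ ω‖ ^ 2 : ℝ) : ℂ) := fun ω => by
      rw [pow_one, pow_one, Complex.star_def, Complex.mul_conj, Complex.normSq_eq_norm_sq]
    rw [mixedMoment, integral_congr_ae (Eventually.of_forall e), integral_complex_ofReal, hvar,
      Complex.ofReal_one]
  obtain ⟨B, hB, hM, hs⟩ := exists_moment_bound (mixedMoment ξ P₀) w.length
  rw [tendsto_iff_norm_sub_tendsto_zero]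
  refine squeeze_zero (fun N => norm_nonneg _) (fun N => norm_expectedTrace_sub_stackCount_le
    (hX N) (hdistrib N) (hindep N) h00 h10 h01 h20 h02 h11 w hB hM hs) ?_
  have hq : Tendsto (fun N => (√(Fintype.card (G N) : ℝ))⁻¹) atTop (𝓝 0) :=
    tendsto_inv_atTop_zero.comp
      (Real.tendsto_sqrt_atTop.comp (tendsto_natCast_atTop_atTop.comp hcard))
  simpa using (hq.const_mul (2 * B ^ w.length * (w.length + 1 : ℝ) ^ w.length)).add
    (hcomm.const_mul (crossingCount w.length 0 : ℝ))

end Limit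

end

theorem theorem4
    -- the finite groups
    (G : ℕ → Type*) [∀ N, Group (G N)] [∀ N, Fintype (G N)] [∀ N, DecidableEq (G N)]
    (hcard : Tendsto (fun N => Fintype.card (G N)) atTop atTop)
    (hplancherel : ConvergesWeakly (fun N => plancherelDimMeasure (G N))
      (Measure.dirac (OnePoint.infty : OnePoint ℕ+)))
    -- the random variable `ξ`
    {Ω₀ : Type*} [MeasurableSpace Ω₀] (P₀ : Measure Ω₀) [IsProbabilityMeasure P₀]
    (ξ : Ω₀ → ℂ)
    (hmoments : ∀ p : ℕ, MemLp ξ p P₀)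
    (hmean : ∫ ω, ξ ω ∂P₀ = 0)
    (hsq : ∫ ω, ξ ω ^ 2 ∂P₀ = 0)
    (hvar : ∫ ω, ‖ξ ω‖ ^ 2 ∂P₀ = 1)
    -- the independent families of independent copies of `ξ`
    (m : ℕ) (Ω : ℕ → Type*) [∀ N, MeasurableSpace (Ω N)] (P : ∀ N, Measure (Ω N))
    [∀ N, IsProbabilityMeasure (P N)]
    (X : ∀ N, Fin m → G N → Ω N → ℂ)
    (hdistrib : ∀ N i g, IdentDistrib (X N i g) ξ (P N) P₀)
    (hindep : ∀ N, iIndepFun (fun p : Fin m × G N => X N p.1 p.2) (P N)) :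
    -- all the expectations of traces below are well defined
    (∀ (N : ℕ) (Q : FreeAlgebra ℂ (Fin m × Bool)),
      Integrable (fun ω => (FreeAlgebra.lift ℂ
        (withAdjoints fun i => randomConvMatrix (X N i)) Q ω).trace) (P N)) ∧
    -- a free family of `m` circular elements exists
    (∃ (A : Type) (_ : CStarAlgebra A) (φ : A →ₗ[ℂ] ℂ) (c : Fin m → A),
      IsState φ ∧ IsFreeCircularFamily φ c) ∧
    -- and the matrices and their adjoints converge in moments to any such family
    (∀ (A : Type*) [CStarAlgebra A] (φ : A →ₗ[ℂ] ℂ) (c : Fin m → A),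
      IsState φ → IsFreeCircularFamily φ c →
      ConvergesInMoments (fun N => expectedTrace (P N))
        (fun N => withAdjoints fun i => randomConvMatrix (X N i))
        φ (withAdjoints c)) := by
  have hX : ∀ N i g, HasAllMoments (X N i g) (P N) := fun N i g p =>
    (hdistrib N i g).memLp_iff.2 (hmoments p)
  refine ⟨fun N Q => integrable_trace_lift (hX N) Q, ⟨_, inferInstance, _, _,
    vacuumState_isState (Fin m × Bool), fockCircular_isFreeCircularFamily m⟩, ?_⟩
  intro A _ φ c hφ hc Q
  induction Q using FreeAlgebra.word_induction with
  | add a b ha hb =>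
    simp only [map_add]
    refine (ha.add hb).congr fun N => ?_
    exact (expectedTrace_add (integrable_trace_lift (hX N) a)
      (integrable_trace_lift (hX N) b)).symm
  | smul r a ha =>
    simp only [map_smul, smul_eq_mul]
    refine (ha.const_mul r).congr fun N => ?_
    exact (expectedTrace_smul r _).symm
  | word w =>
    simp only [FreeAlgebra.lift_word]
    rw [hc.moments_eq_stackCount hφ.map_one]
    exact tendsto_expectedTrace_word G hcard (tendsto_commProb G hplancherel) hmean hsq hvar Ω P X
      hX hdistrib hindep w
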